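/- **Conventions.** Circuits are finite lists of gates from the universal set $\{H, T, T^\dagger, \mathrm{CNOT}\}$ on $n$ qubits; the size of a circuit is its number of gates; a circuit is identified with its $2^n\times 2^n$ unitary matrix, and is described to a classical machine by a bit string listing $n$ (in unary) and its gates. Polynomial time refers to classical machines with finitely many stacks of bits (equivalently, up to a polynomial, multi-tape Turing machines), with oracle calls where indicated. **The cost.** For $n\ge 1$ and $n$-qubit unitaries $U,V$ put $W=UV^\dagger$ and, for $j=1,\dots,n$, let $$\mathcal E_j(\rho)=\mathrm{Tr}_{\bar A_j}\!\left(W\Big(\rho_{A_j}\otimes \frac{\mathbb 1_{\bar A_j}}{2^{n-1}}\Big)W^\dagger\right),\qquad F_e^{(j)}=\mathrm{Tr}\big(|\Phi^+\rangle\langle\Phi^+|\,(\mathcal E_j\otimes\mathcal I)(|\Phi^+\rangle\langle\Phi^+|)\big),$$ where $\bar A_j$ denotes all qubits except the $j$-th and $|\Phi^+\rangle=(|00\rangle+|11\rangle)/\sqrt2$. The local Hilbert–Schmidt cost is $$C_{\mathrm{LHST}}(U,V)=\frac1n\sum_{j=1}^n\big(1-F_e^{(j)}\big).$$ **The class DQC1.**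 For a circuit $Q$ on $m+1$ qubits let $p_{\mathrm{acc}}(Q)=\mathrm{Tr}\big[(|0\rangle\langle0|\otimes\mathbb 1)\,Q\,\rho\, Q^\dagger\big]$ with $\rho=|0\rangle\langle 0|\otimes(\mathbb 1/2)^{\otimes m}$. A promise problem $(L_{\rm yes},L_{\rm no})$ is in $\mathsf{DQC1}$ if there are a polynomial-time computable map $x\mapsto Q_x$ from bit strings to such circuits and a polynomial $q$ with coefficients in $\mathbb N$ such that $p_{\mathrm{acc}}(Q_x)\ge \frac12+\frac1{q(|x|)+1}$ for $x\in L_{\rm yes}$ and $p_{\mathrm{acc}}(Q_x)\le\frac12-\frac1{q(|x|)+1}$ for $x\in L_{\rm no}$. **The approximation problem.** Given a polynomial $s$ and $\epsilon:\mathbb N\to(0,\infty)$, the problem $\mathrm{LHST}_{s,\epsilon}$ is: on input descriptions of two circuits $U,V$ on the same number $n\ge1$ of qubits, each of size at most $s(n)$, output a finite binary expansion $0.b_1b_2\cdots b_\ell$ of a number $c$ with $|c-C_{\mathrm{LHST}}(U,V)|\le\epsilon(n)$. **Theorem.** There is a polynomial $s$ such that for every function $\epsilon:\mathbb N\to(0,\infty)$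 with $\epsilon(n)=O(n^{-k})$ for some integer $k\ge1$, the problem $\mathrm{LHST}_{s,\epsilon}$ is $\mathsf{DQC1}$-hard under polynomial-time Turing reductions: for every promise problem $(L_{\rm yes},L_{\rm no})$ in $\mathsf{DQC1}$ there is a polynomial-time oracle machine which, given any oracle that answers all instances of $\mathrm{LHST}_{s,\epsilon}$ correctly, halts in polynomial time on every input $x$, accepts if $x\in L_{\rm yes}$ and rejects if $x\in L_{\rm no}$. -/

import Mathlib

open Filter Asymptotics

/-! ## Quantum circuits

The computational basis of `n` qubits is indexed by the bit strings `Fin n → Bool`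
(`false` is `0`, `true` is `1`).  Circuits are written over the universal gate set
`H`, `T`, `T†`, `CNOT`. -/

/-- A gate of the gate set, together with the qubit(s) of an `n`-qubit register it acts on. -/
inductive Gate (n : ℕ) : Type
  | had (i : Fin n)
  | tee (i : Fin n)
  | teeDag (i : Fin n)
  | cnot (control target : Fin n) (ne : control ≠ target)

/-- A circuit on `n` qubits: the list of its gates, in the order in which they are applied.
Its size is the length of the list. -/
abbrev Circuit (n : ℕ) : Type := List (Gate n)

/-- Operators on the Hilbert space of `n` qubits, in the computational basis. -/
abbrev QOp (n : ℕ) : Type := Matrix (Fin n → Bool) (Fin n → Bool) ℂ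

/-- The Hadamard matrix. -/
noncomputable def hadMat : Matrix Bool Bool ℂ :=
  fun a b => (if a && b then -1 else 1) / (Real.sqrt 2 : ℂ)

/-- The matrix `diag (1, ω)`. -/
def phaseMat (ω : ℂ) : Matrix Bool Bool ℂ :=
  fun a b => if a = b then (if a then ω else 1) else 0

/-- The one-qubit operator `g` acting on qubit `i`, tensored with the identity elsewhere. -/
def onQubit {n : ℕ} (i : Fin n) (g : Matrix Bool Bool ℂ) : QOp n :=
  fun x y => if ∀ k, k ≠ i → x k = y k then g (x i) (y i) else 0

/-- The unitary matrix of a gate. -/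
noncomputable def Gate.toOp {n : ℕ} : Gate n → QOp n
  | .had i => onQubit i hadMat
  | .tee i => onQubit i (phaseMat (Complex.exp (Complex.I * (Real.pi / 4 : ℝ))))
  | .teeDag i => onQubit i (phaseMat (Complex.exp (-(Complex.I * (Real.pi / 4 : ℝ)))))
  | .cnot c t _ => fun x y => if x = Function.update y t (xor (y c) (y t)) then 1 else 0

/-- The unitary matrix of a circuit (the first gate of the list is applied first). -/
noncomputable def Circuit.toOp {n : ℕ} : Circuit n → QOp n
  | [] => 1
  | g :: c => Circuit.toOp c * g.toOp

/-! ## The local Hilbert-Schmidt cost -/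

/-- `ρ ⊗ 1 / 2 ^ (n - 1)`: the state `ρ` on qubit `j`, all other qubits maximally mixed. -/
noncomputable def withMixed {n : ℕ} (j : Fin n) (ρ : Matrix Bool Bool ℂ) : QOp n :=
  ((1 : ℂ) / 2 ^ (n - 1)) • onQubit j ρ

/-- The partial trace over all qubits except qubit `j`. -/
def traceOthers {n : ℕ} (j : Fin n) (M : QOp n) : Matrix Bool Bool ℂ :=
  fun a b => ∑ x : Fin n → Bool, if x j = a then M x (Function.update x j b) else 0

/-- The local channel `ρ ↦ Tr_{all but j} (W (ρ ⊗ 1 / 2 ^ (n - 1)) W†)` on qubit `j`. -/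
noncomputable def localChannel {n : ℕ} (W : QOp n) (j : Fin n) (ρ : Matrix Bool Bool ℂ) :
    Matrix Bool Bool ℂ :=
  traceOthers j (W * withMixed j ρ * W.conjTranspose)

/-- `E ⊗ id` for a map `E` on one-qubit operators, applied to a two-qubit operator. -/
def tensorId (E : Matrix Bool Bool ℂ → Matrix Bool Bool ℂ)
    (σ : Matrix (Bool × Bool) (Bool × Bool) ℂ) : Matrix (Bool × Bool) (Bool × Bool) ℂ :=
  fun p q => E (fun c d => σ (c, p.2) (d, q.2)) p.1 q.1

/-- The two-qubit maximally entangled state `(|00⟩ + |11⟩) / √2`. -/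
noncomputable def bellVec : Bool × Bool → ℂ :=
  fun p => if p.1 = p.2 then 1 / (Real.sqrt 2 : ℂ) else 0

/-- The projector onto the two-qubit maximally entangled state. -/
noncomputable def bellProj : Matrix (Bool × Bool) (Bool × Bool) ℂ :=
  Matrix.vecMulVec bellVec (star bellVec)

/-- The entanglement fidelity of the local channel of `W = U V†` on qubit `j`. -/
noncomputable def localFidelity {n : ℕ} (U V : QOp n) (j : Fin n) : ℝ :=
  (Matrix.trace (bellProj * tensorId (localChannel (U * V.conjTranspose) j) bellProj)).re

/-- The local Hilbert-Schmidt test cost `C_LHST(U, V)`. -/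
noncomputable def costLHST {n : ℕ} (U V : QOp n) : ℝ :=
  (1 / (n : ℝ)) * ∑ j : Fin n, (1 - localFidelity U V j)

/-! ## Descriptions of circuits by bit strings -/

/-- A natural number in unary, terminated by `false`. -/
def unaryCode (k : ℕ) : List Bool := List.replicate k true ++ [false]

/-- A two-bit opcode followed by the qubit(s) in unary. -/
def Gate.code {n : ℕ} : Gate n → List Bool
  | .had i => [false, false] ++ unaryCode i
  | .tee i => [false, true] ++ unaryCode i
  | .teeDag i => [true, false] ++ unaryCode i
  | .cnot c t _ => [true, true] ++ unaryCode c ++ unaryCode t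

/-- The gates one after the other, each preceded by `true`, the last one followed by `false`. -/
def gatesCode {n : ℕ} : Circuit n → List Bool
  | [] => [false]
  | g :: c => true :: (g.code ++ gatesCode c)

/-- The description of a circuit: its number of qubits in unary, then its gates. -/
def circuitCode {n : ℕ} (c : Circuit n) : List Bool := unaryCode n ++ gatesCode c

/-- The description of a pair of circuits on the same number of qubits. -/
def pairCode {n : ℕ} (U V : Circuit n) : List Bool := circuitCode U ++ circuitCode V

/-! ## A machine model: programs with finitely many stacks of bits

A program works on stacks of bits (the head of the list is the top of the stack); the stacks are
numbered, and a program mentions only finitely many of them.  Each elementary operation touches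
one symbol and takes one step, so up to a polynomial this is the time of a multi-tape Turing
machine.  A call of the oracle on a word `w` takes `|w| + 1` steps. -/

/-- The contents of the stacks. -/
abbrev Store : Type := ℕ → List Bool

inductive Prog : Type
  | skip
  | push (r : ℕ) (b : Bool)
  | pop (r : ℕ)
  | seq (P Q : Prog)
  /-- look at the top of stack `r`: three continuations for empty / `false` / `true` -/
  | branch (r : ℕ) (Pnil Pfalse Ptrue : Prog)
  /-- repeat `P` as long as stack `r` is not empty -/
  | loop (r : ℕ) (P : Prog)
  /-- replace stack `a` by the oracle's answer to the contents of stack `q` -/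
  | query (q a : ℕ)

/-- `Prog.Runs O P s t s'`: with oracle `O` and initial store `s`, the program `P` halts after
exactly `t` steps with store `s'`. -/
inductive Prog.Runs (O : List Bool → List Bool) : Prog → Store → ℕ → Store → Prop
  | skip (s : Store) : Runs O .skip s 1 s
  | push (r : ℕ) (b : Bool) (s : Store) :
      Runs O (.push r b) s 1 (Function.update s r (b :: s r))
  | pop (r : ℕ) (s : Store) : Runs O (.pop r) s 1 (Function.update s r (s r).tail)
  | seq {P Q : Prog} {s s' s'' : Store} {t t' : ℕ} :
      Runs O P s t s' → Runs O Q s' t' s'' → Runs O (.seq P Q) s (t + t') s''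
  | branch_nil {r : ℕ} {P₀ P₁ P₂ : Prog} {s s' : Store} {t : ℕ} :
      s r = [] → Runs O P₀ s t s' → Runs O (.branch r P₀ P₁ P₂) s (t + 1) s'
  | branch_false {r : ℕ} {P₀ P₁ P₂ : Prog} {s s' : Store} {t : ℕ} :
      (s r).head? = some false → Runs O P₁ s t s' → Runs O (.branch r P₀ P₁ P₂) s (t + 1) s'
  | branch_true {r : ℕ} {P₀ P₁ P₂ : Prog} {s s' : Store} {t : ℕ} :
      (s r).head? = some true → Runs O P₂ s t s' → Runs O (.branch r P₀ P₁ P₂) s (t + 1) s'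
  | loop_done {r : ℕ} {P : Prog} {s : Store} : s r = [] → Runs O (.loop r P) s 1 s
  | loop_step {r : ℕ} {P : Prog} {s s' s'' : Store} {t t' : ℕ} :
      s r ≠ [] → Runs O P s t s' → Runs O (.loop r P) s' t' s'' →
      Runs O (.loop r P) s (t + t' + 1) s''
  | query (q a : ℕ) (s : Store) :
      Runs O (.query q a) s ((s q).length + 1) (Function.update s a (O (s q)))

/-- The program makes no oracle calls. -/
def Prog.QueryFree : Prog → Prop
  | .skip => True
  | .push _ _ => True
  | .pop _ => True
  | .seq P Q => P.QueryFree ∧ Q.QueryFree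
  | .branch _ P Q R => P.QueryFree ∧ Q.QueryFree ∧ R.QueryFree
  | .loop _ P => P.QueryFree
  | .query _ _ => False

/-- The initial store: the input on stack `0`, all other stacks empty. -/
def initStore (x : List Bool) : Store := fun r => if r = 0 then x else []

/-- `f` is computed in polynomial time by a program without oracle calls
(the output is the final contents of stack `1`). -/
def PolyTimeComputable (f : List Bool → List Bool) : Prop :=
  ∃ P : Prog, P.QueryFree ∧ ∃ p : Polynomial ℕ, ∀ x : List Bool, ∃ (t : ℕ) (s : Store),
    P.Runs (fun _ => []) (initStore x) t s ∧ t ≤ p.eval x.length ∧ s 1 = f x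

/-! ## The class DQC1 -/

/-- A promise problem: disjoint sets of yes- and no-instances. -/
structure PromiseProblem where
  yes : Set (List Bool)
  no : Set (List Bool)
  disj : Disjoint yes no

/-- The projector `|0⟩⟨0| ⊗ 1` of `m + 1` qubits, the first of which is the clean one. -/
def cleanProj (m : ℕ) : QOp (m + 1) :=
  Matrix.diagonal fun x => if x 0 = false then 1 else 0

/-- The input `|0⟩⟨0| ⊗ (1 / 2) ^ ⊗ m` of the one-clean-qubit model. -/
noncomputable def cleanState (m : ℕ) : QOp (m + 1) := ((1 : ℂ) / 2 ^ m) • cleanProj m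

/-- The probability of the outcome `0` when `Q` is applied to one clean and `m` maximally mixed
qubits and the clean qubit is then measured: `Tr ((|0⟩⟨0| ⊗ 1) Q ρ Q†)`. -/
noncomputable def acceptProb {m : ℕ} (Q : Circuit (m + 1)) : ℝ :=
  (Matrix.trace (cleanProj m * Q.toOp * cleanState m * Q.toOp.conjTranspose)).re

/-- `L` is in DQC1: a polynomial-time algorithm maps each input `x` to a one-clean-qubit circuit
`Q x` whose acceptance probability is at least `1/2 + δ` on yes-instances and at most `1/2 - δ` on
no-instances, with `δ` at least an inverse polynomial in the length of `x`.  (Polynomially many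
repetitions then make the error as small as one likes.  The acceptance probabilities `2/3` and
`1/3` are the special case `q = 5`.) -/
def InDQC1 (L : PromiseProblem) : Prop :=
  ∃ (m : List Bool → ℕ) (Q : (x : List Bool) → Circuit (m x + 1)) (q : Polynomial ℕ),
    PolyTimeComputable (fun x => circuitCode (Q x)) ∧
    (∀ x ∈ L.yes, 1 / 2 + 1 / (((q.eval x.length : ℕ) : ℝ) + 1) ≤ acceptProb (Q x)) ∧
    (∀ x ∈ L.no, acceptProb (Q x) ≤ 1 / 2 - 1 / (((q.eval x.length : ℕ) : ℝ) + 1))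

/-! ## Hardness of approximation -/

/-- A function problem: `R w y` says that `y` is an admissible answer to the question `w`. -/
abbrev FunctionProblem : Type := List Bool → List Bool → Prop

/-- `L` reduces to `R` in polynomial time (Turing reduction): one polynomial-time oracle program
decides `L` whenever the oracle always gives admissible answers. -/
def TuringReduces (L : PromiseProblem) (R : FunctionProblem) : Prop :=
  ∃ (P : Prog) (p : Polynomial ℕ), ∀ O : List Bool → List Bool, (∀ w, R w (O w)) →
    ∀ x : List Bool, ∃ (t : ℕ) (s : Store),
      P.Runs O (initStore x) t s ∧ t ≤ p.eval x.length ∧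
      (x ∈ L.yes → s 1 = [true]) ∧ (x ∈ L.no → s 1 = [false])

/-- Every problem in DQC1 reduces to `R`. -/
def IsDQC1Hard (R : FunctionProblem) : Prop :=
  ∀ L : PromiseProblem, InDQC1 L → TuringReduces L R

/-- The number with binary expansion `0.b₁b₂b₃…`. -/
noncomputable def binFrac : List Bool → ℝ
  | [] => 0
  | b :: l => ((if b then 1 else 0) + binFrac l) / 2

/-- Approximating `C_LHST(U, V)` up to `ε n`: an instance is a pair of circuits `U`, `V` on
`n ≥ 1` qubits with at most `size n` gates each; an answer is a number in binary. -/
def approxLHST (size : Polynomial ℕ) (ε : ℕ → ℝ) : FunctionProblem := fun w y =>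
  ∀ (n : ℕ) (U V : Circuit n), 0 < n → U.length ≤ size.eval n → V.length ≤ size.eval n →
    w = pairCode U V → |binFrac y - costLHST U.toOp V.toOp| ≤ ε n

/-!
Let `Q` be a one-clean-qubit circuit on `m + 1` qubits. Add `N` idle qubits and let `C` be the
product of the `CNOT` gates from the clean qubit to the added ones (`fanOut`). The reduction asks
for the cost of the pair `U = C Q`, `V = Q C`, so that `W = U V† = C Q C Q†`. No inverse of `Q`
has to be written down, and the codes of `U` and `V` are obtained from that of `Q` by
concatenation.

The operator `W` commutes with the bit flip on every added qubit `j`, so the local channel at `j` is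
a mixture of the identity and the bit flip, and its fidelity is determined by `Tr (Z_j W Z_j W†)`
(`localFidelity_of_flip_invariant`). Since `Q` commutes with `Z_j` and `C Z_j C = Z_0 Z_j`, this
trace is `Tr (Z_0 Q Z_0 Q†)`, which also determines the acceptance probability of `Q`
(`acceptProb_eq`). Hence the fidelity at each added qubit is exactly `acceptProb Q`
(`localFidelity_fan`). The remaining `m + 1` qubits contribute a bounded amount each, so for large
`N` the cost is close to `1 - acceptProb Q` (`costLHST_fan_mem_Icc`). This is a signal in the whole
average and not in a single summand, so an error `C / n` does no harm when `N` is a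
sufficiently large polynomial in the length of the input: the first bit of the oracle's answer
decides (`head_answer`). As `N` also exceeds the size of `Q`, both circuits have at most
`2 n` gates.

On the machine side, the program that computes `Q` is moved to the stacks from number `8` on
(`Prog.Runs.shift`), which keeps it apart from the stacks `0`, ..., `7` of the reduction.
The latter computes `N = (|x| + c) ^ d` in unary and writes the question from its end to its
beginning (`Prog.does_writeQuestion`), almost entirely with one kind of loop, `Prog.drain`.
-/

/-! ### Bit flips, Pauli operators and permutations of the basis -/

/-- Flip of bit `j`, as a permutation of the computational basis. -/
def flipBit {n : ℕ} (j : Fin n) : Equiv.Perm (Fin n → Bool) where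
  toFun x := Function.update x j (!x j)
  invFun x := Function.update x j (!x j)
  left_inv x := by simp
  right_inv x := by simp

theorem flipBit_apply {n : ℕ} (j : Fin n) (x : Fin n → Bool) :
    flipBit j x = Function.update x j (!x j) := rfl

/-- The sign `(-1) ^ b`. -/
def bitSign (b : Bool) : ℂ := if b then -1 else 1

/-- Pauli `Z` on qubit `j`. -/
def pauliZ {n : ℕ} (j : Fin n) : QOp n := Matrix.diagonal fun x => bitSign (x j)

/-- The operator mapping the basis vector `y` to the basis vector `σ y`. -/
def permOp {n : ℕ} (σ : (Fin n → Bool) → (Fin n → Bool)) : QOp n :=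
  fun x y => if x = σ y then 1 else 0

theorem permOp_mul {n : ℕ} (σ τ : (Fin n → Bool) → (Fin n → Bool)) :
    permOp σ * permOp τ = permOp (σ ∘ τ) := by
  ext x y
  simp [Matrix.mul_apply, permOp]

theorem permOp_id {n : ℕ} : permOp (id : (Fin n → Bool) → _) = 1 := by
  ext x y
  simp [permOp, Matrix.one_apply]

theorem permOp_conjTranspose {n : ℕ} {σ : (Fin n → Bool) → (Fin n → Bool)}
    (h : Function.Involutive σ) : (permOp σ).conjTranspose = permOp σ := by
  ext x y
  have : y = σ x ↔ x = σ y := ⟨fun e => by rw [e, h], fun e => by rw [e, h]⟩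
  simp [permOp, Matrix.conjTranspose_apply, this, apply_ite]

/-! ### Unitarity of circuits -/

theorem onQubit_mul {n : ℕ} (i : Fin n) (g h : Matrix Bool Bool ℂ) :
    onQubit i g * onQubit i h = onQubit i (g * h) := by
  ext x y
  have key : ∀ z : Fin n → Bool, onQubit i g x z * onQubit i h z y =
      ∑ b, if z = Function.update x i b then
        (if ∀ k, k ≠ i → x k = y k then g (x i) b * h b (y i) else 0) else 0 := by
    intro z
    by_cases hz : ∀ k, k ≠ i → x k = z k
    · have e : z = Function.update x i (z i) := by
        ext k
        by_cases hk : k = i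
        · subst hk; simp
        · simp [hk, hz k hk]
      rw [Finset.sum_eq_single (z i)]
      · rw [if_pos e]
        have : (∀ k, k ≠ i → z k = y k) ↔ ∀ k, k ≠ i → x k = y k :=
          forall₂_congr fun k hk => by rw [hz k hk]
        simp [onQubit, if_pos hz, this]
      · intro b _ hb
        rw [if_neg]
        rintro e'
        exact hb (by rw [e']; simp)
      · simp
    · rw [Finset.sum_eq_zero]
      · simp [onQubit, if_neg hz]
      · intro b _
        rw [if_neg]
        rintro rfl
        exact hz fun k hk => by simp [hk]
  rw [Matrix.mul_apply, Finset.sum_congr rfl fun z _ => key z, Finset.sum_comm]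
  by_cases hxy : ∀ k, k ≠ i → x k = y k <;> simp [onQubit, hxy, Matrix.mul_apply]

theorem onQubit_one {n : ℕ} (i : Fin n) : onQubit i (1 : Matrix Bool Bool ℂ) = 1 := by
  ext x y
  have : x = y ↔ (∀ k, k ≠ i → x k = y k) ∧ x i = y i := by
    constructor
    · rintro rfl; simp
    · rintro ⟨h, h'⟩
      ext k
      by_cases hk : k = i
      · subst hk; exact h'
      · exact h k hk
  simp only [onQubit, Matrix.one_apply, this]
  split_ifs <;> simp_all

theorem onQubit_conjTranspose {n : ℕ} (i : Fin n) (g : Matrix Bool Bool ℂ) :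
    (onQubit i g).conjTranspose = onQubit i g.conjTranspose := by
  ext x y
  have : (∀ k, k ≠ i → y k = x k) ↔ ∀ k, k ≠ i → x k = y k :=
    forall₂_congr fun k _ => eq_comm
  simp only [onQubit, Matrix.conjTranspose_apply, this]
  split_ifs <;> simp

theorem hadMat_mul_conjTranspose : hadMat * hadMat.conjTranspose = 1 := by
  have h : ((Real.sqrt 2 : ℝ) : ℂ) * (Real.sqrt 2 : ℝ) = 2 := by
    rw [← Complex.ofReal_mul, Real.mul_self_sqrt (by norm_num)]; simp
  have h0 : ((Real.sqrt 2 : ℝ) : ℂ) ≠ 0 := by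
    intro e; rw [e] at h; norm_num at h
  ext a b
  cases a <;> cases b <;>
    simp [Matrix.mul_apply, hadMat, Complex.conj_ofReal] <;> field_simp <;>
    first | ring1 | linear_combination h | linear_combination (-1 : ℂ) * h

theorem phaseMat_mul_conjTranspose {ω : ℂ} (h : ω * star ω = 1) :
    phaseMat ω * (phaseMat ω).conjTranspose = 1 := by
  ext a b
  cases a <;> cases b <;>
    simp_all [Matrix.mul_apply, phaseMat]

/-- The action of `CNOT` on the computational basis. -/
def cnotFun {n : ℕ} (c t : Fin n) (y : Fin n → Bool) : Fin n → Bool :=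
  Function.update y t (xor (y c) (y t))

theorem cnotFun_involutive {n : ℕ} {c t : Fin n} (h : c ≠ t) :
    Function.Involutive (cnotFun c t) := by
  intro y
  simp [cnotFun, h]

theorem toOp_cnot {n : ℕ} (c t : Fin n) (h : c ≠ t) :
    (Gate.cnot c t h).toOp = permOp (cnotFun c t) := rfl

theorem Gate.toOp_mul_conjTranspose {n : ℕ} (g : Gate n) : g.toOp * g.toOp.conjTranspose = 1 := by
  have phase : ∀ (i : Fin n) (r : ℝ), onQubit i (phaseMat (Complex.exp (Complex.I * r))) *
      (onQubit i (phaseMat (Complex.exp (Complex.I * r)))).conjTranspose = 1 := by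
    intro i r
    rw [onQubit_conjTranspose, onQubit_mul, phaseMat_mul_conjTranspose, onQubit_one]
    rw [← starRingEnd_apply, ← Complex.exp_conj, ← Complex.exp_add]
    simp
  cases g with
  | had i =>
    simp only [Gate.toOp]
    rw [onQubit_conjTranspose, onQubit_mul, hadMat_mul_conjTranspose, onQubit_one]
  | tee i => exact phase i _
  | teeDag i =>
    have := phase i (-(Real.pi / 4))
    simp only [Gate.toOp]
    convert this using 5 <;> push_cast <;> ring_nf
  | cnot c t h =>
    rw [toOp_cnot, permOp_conjTranspose (cnotFun_involutive h), permOp_mul,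
      (cnotFun_involutive h).comp_self, permOp_id]

theorem Circuit.toOp_mul_conjTranspose {n : ℕ} (c : Circuit n) :
    Circuit.toOp c * (Circuit.toOp c).conjTranspose = 1 := by
  induction c with
  | nil => simp [Circuit.toOp]
  | cons g c ih =>
    rw [Circuit.toOp, Matrix.conjTranspose_mul, Matrix.mul_assoc, ← Matrix.mul_assoc g.toOp,
      g.toOp_mul_conjTranspose, Matrix.one_mul, ih]

theorem Circuit.toOp_append {n : ℕ} (c d : Circuit n) :
    Circuit.toOp (c ++ d) = Circuit.toOp d * Circuit.toOp c := by
  induction c with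
  | nil => simp [Circuit.toOp]
  | cons g c ih => simp only [List.cons_append, Circuit.toOp, ih, Matrix.mul_assoc]

/-! ### The local fidelity in coordinates -/

theorem trace_mul_conjTranspose {n : ℕ} (W : QOp n) :
    Matrix.trace (W * W.conjTranspose) = ∑ x, ∑ y, W x y * star (W x y) := by
  simp [Matrix.trace, Matrix.mul_apply, Matrix.conjTranspose_apply]

theorem trace_one_qop (n : ℕ) : Matrix.trace (1 : QOp n) = 2 ^ n := by
  simp [Matrix.trace_one]

theorem sum_normSq_of_unitary {n : ℕ} {W : QOp n} (hW : W * W.conjTranspose = 1) :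
    ∑ x, ∑ y, ‖W x y‖ ^ 2 = 2 ^ n := by
  have h := trace_mul_conjTranspose W
  rw [hW, trace_one_qop] at h
  have e : ∀ z : ℂ, z * star z = ((‖z‖ ^ 2 : ℝ) : ℂ) := by
    intro z
    rw [← starRingEnd_apply, Complex.mul_conj, Complex.normSq_eq_norm_sq]
  simp only [e] at h
  exact_mod_cast h.symm

/-- The local channel on a matrix unit, in coordinates. -/
theorem localChannel_single {n : ℕ} (W : QOp n) (j : Fin n) (a b : Bool) :
    localChannel W j (Matrix.single b a 1) b a = 1 / 2 ^ (n - 1) * ∑ x, ∑ y,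
      if x j = b ∧ y j = b then
        W x y * star (W (Function.update x j a) (Function.update y j a)) else 0 := by
  have h1 : ∀ x : Fin n → Bool, (W * onQubit j (Matrix.single b a 1) * W.conjTranspose) x
      (Function.update x j a) = ∑ y, if y j = b then
        W x y * star (W (Function.update x j a) (Function.update y j a)) else 0 := by
    intro x
    rw [Matrix.mul_assoc, Matrix.mul_apply]
    refine Finset.sum_congr rfl fun y _ => ?_
    rw [Matrix.mul_apply, Finset.sum_eq_single (Function.update y j a)]
    · by_cases hy : y j = b
      · have : ∀ k, k ≠ j → y k = Function.update y j a k := fun k hk => by simp [hk]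
        rw [onQubit, if_pos this]
        simp [hy]
      · simp [onQubit, hy, Ne.symm hy]
    · intro z _ hz
      by_cases hyz : ∀ k, k ≠ j → y k = z k
      · have : z j ≠ a := by
          rintro rfl
          apply hz
          ext k
          by_cases hk : k = j
          · subst hk; simp
          · simp [hk, hyz k hk]
        simp [onQubit, this.symm]
      · simp [onQubit, if_neg hyz]
    · simp
  rw [localChannel, withMixed, Matrix.mul_smul, Matrix.smul_mul, traceOthers, Finset.mul_sum]
  refine Finset.sum_congr rfl fun x _ => ?_
  rw [Matrix.smul_apply, h1, smul_eq_mul]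
  by_cases hx : x j = b <;> simp [hx]

/-- For a homogeneous map `E`, the overlap of `(E ⊗ id)` of the Bell state with the Bell state is
the average over `a`, `b` of the entries of `E(|b⟩⟨a|)` at `(b, a)`. -/
theorem trace_bellProj_tensorId {E : Matrix Bool Bool ℂ → Matrix Bool Bool ℂ}
    (hE : ∀ (c : ℂ) ρ, E (c • ρ) = c • E ρ) :
    Matrix.trace (bellProj * tensorId E bellProj) =
      1 / 4 * ∑ b, ∑ a, E (Matrix.single b a 1) b a := by
  have h : ((Real.sqrt 2 : ℝ) : ℂ) * (Real.sqrt 2 : ℝ) = 2 := by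
    rw [← Complex.ofReal_mul, Real.mul_self_sqrt (by norm_num)]; simp
  have hb : ∀ p q : Bool × Bool, bellProj p q =
      if p.1 = p.2 ∧ q.1 = q.2 then 1 / 2 else 0 := by
    intro p q
    by_cases hp : p.1 = p.2 <;> by_cases hq : q.1 = q.2 <;>
      simp [bellProj, bellVec, Matrix.vecMulVec_apply, hp, hq, Complex.conj_ofReal, ← mul_inv, h]
  have hs : ∀ p q : Bool × Bool,
      tensorId E bellProj p q = 1 / 2 * E (Matrix.single p.2 q.2 1) p.1 q.1 := by
    intro p q
    have : (Matrix.of fun c d : Bool => bellProj (c, p.2) (d, q.2)) =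
        (1 / 2 : ℂ) • Matrix.single p.2 q.2 1 := by
      ext c d
      rw [Matrix.of_apply, hb, Matrix.smul_apply, Matrix.single_apply]
      simp [eq_comm]
    calc tensorId E bellProj p q =
          E (Matrix.of fun c d : Bool => bellProj (c, p.2) (d, q.2)) p.1 q.1 := rfl
      _ = _ := by rw [this, hE, Matrix.smul_apply, smul_eq_mul]
  simp only [Matrix.trace, Matrix.diag, Matrix.mul_apply, Fintype.sum_prod_type,
    Fintype.sum_bool, hs, hb]
  simp
  ring

theorem update_eq_ite_flipBit {n : ℕ} (j : Fin n) (x : Fin n → Bool) (a : Bool) :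
    Function.update x j a = if x j = a then x else flipBit j x := by
  split_ifs with h
  · subst h; simp
  · rw [flipBit_apply]
    congr 1
    cases a <;> simp_all

/-- The local fidelity in coordinates, where the sum over matrix units is folded into the identity
and the flip of qubit `j`. -/
theorem localFidelity_eq {n : ℕ} (U V : QOp n) (j : Fin n) {W : QOp n}
    (hW : W = U * V.conjTranspose) :
    localFidelity U V j = 1 / 2 ^ (n + 1) * (∑ x, ∑ y, if x j = y j then
      W x y * star (W x y + W (flipBit j x) (flipBit j y)) else 0).re := by
  have hn : n - 1 + 2 = n + 1 := by have := j.pos; omega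
  have hE : ∀ (c : ℂ) ρ, localChannel W j (c • ρ) = c • localChannel W j ρ := by
    intro c ρ
    have h1 : withMixed j (c • ρ) = c • withMixed j ρ := by
      ext x y
      simp only [withMixed, onQubit, Matrix.smul_apply, smul_eq_mul]
      split_ifs <;> ring
    ext a b
    simp only [localChannel, h1, Matrix.mul_smul, Matrix.smul_mul, traceOthers,
      Matrix.smul_apply, smul_eq_mul, Finset.mul_sum, mul_ite, mul_zero]
  have key : ∑ b, ∑ a, localChannel W j (Matrix.single b a 1) b a =
      1 / 2 ^ (n - 1) * ∑ x, ∑ y, if x j = y j then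
      W x y * star (W x y + W (flipBit j x) (flipBit j y)) else 0 := by
    simp only [localChannel_single, ← Finset.mul_sum, Fintype.sum_bool, ← Finset.sum_add_distrib]
    congr 1
    refine Finset.sum_congr rfl fun x _ => Finset.sum_congr rfl fun y _ => ?_
    simp only [update_eq_ite_flipBit]
    cases hx : x j <;> cases hy : y j <;> simp <;> ring
  rw [localFidelity, ← hW, trace_bellProj_tensorId hE, key, ← mul_assoc]
  have : (1 / 4 * (1 / 2 ^ (n - 1)) : ℂ) = ((1 / 2 ^ (n + 1) : ℝ) : ℂ) := by
    rw [← hn, pow_add]; push_cast; ring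
  rw [this, Complex.re_ofReal_mul]

/-- Only the bound for unitary `W` is needed. The mixed terms are absorbed into `∑ |W x y| ^ 2` by
`2 a b ≤ a ^ 2 + b ^ 2`; nonnegativity of the fidelity plays no role. -/
theorem abs_localFidelity_le_one {n : ℕ} (U V : QOp n) (j : Fin n)
    (hU : (U * V.conjTranspose) * (U * V.conjTranspose).conjTranspose = 1) :
    |localFidelity U V j| ≤ 1 := by
  set W := U * V.conjTranspose with hW
  have hs := sum_normSq_of_unitary hU
  have hs' : ∑ x, ∑ y, ‖W (flipBit j x) (flipBit j y)‖ ^ 2 = 2 ^ n := by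
    rw [← hs]
    exact (Equiv.sum_comp (flipBit j) fun x => ∑ y, ‖W x (flipBit j y)‖ ^ 2).trans
      (Finset.sum_congr rfl fun x _ => Equiv.sum_comp (flipBit j) fun y => ‖W x y‖ ^ 2)
  rw [localFidelity_eq U V j hW, abs_mul, abs_of_nonneg (by positivity)]
  have hb : ‖∑ x, ∑ y, if x j = y j then
      W x y * star (W x y + W (flipBit j x) (flipBit j y)) else 0‖ ≤
      ∑ x, ∑ y, (3 / 2 * ‖W x y‖ ^ 2 + 1 / 2 * ‖W (flipBit j x) (flipBit j y)‖ ^ 2) := by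
    refine (norm_sum_le _ _).trans (Finset.sum_le_sum fun x _ =>
      (norm_sum_le _ _).trans (Finset.sum_le_sum fun y _ => ?_))
    split_ifs
    · rw [norm_mul, norm_star]
      have h1 := norm_add_le (W x y) (W (flipBit j x) (flipBit j y))
      have h2 := mul_le_mul_of_nonneg_left h1 (norm_nonneg (W x y))
      nlinarith [sq_nonneg (‖W x y‖ - ‖W (flipBit j x) (flipBit j y)‖)]
    · rw [norm_zero]; positivity
  simp only [Finset.sum_add_distrib, ← Finset.mul_sum, hs, hs'] at hb
  have := (Complex.abs_re_le_norm _).trans hb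
  calc _ ≤ 1 / 2 ^ (n + 1) * (3 / 2 * 2 ^ n + 1 / 2 * (2 : ℝ) ^ n) :=
        mul_le_mul_of_nonneg_left this (by positivity)
    _ = 1 := by rw [pow_succ]; field_simp; norm_num

theorem bitSign_mul_bitSign (a b : Bool) :
    bitSign a * bitSign b = if a = b then 1 else -1 := by
  cases a <;> cases b <;> simp [bitSign]

theorem bitSign_mul_self (a : Bool) : bitSign a * bitSign a = 1 := by
  simp [bitSign_mul_bitSign]

theorem pauliZ_mul_self {n : ℕ} (j : Fin n) : pauliZ j * pauliZ j = 1 := by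
  simp [pauliZ, bitSign_mul_self]

theorem trace_pauliZ_conj {n : ℕ} (j k : Fin n) (W : QOp n) :
    Matrix.trace (pauliZ j * W * pauliZ k * W.conjTranspose) =
      ∑ x, ∑ y, bitSign (x j) * bitSign (y k) * (W x y * star (W x y)) := by
  rw [Matrix.trace]
  refine Finset.sum_congr rfl fun x _ => ?_
  rw [Matrix.diag, Matrix.mul_apply]
  refine Finset.sum_congr rfl fun y _ => ?_
  simp only [pauliZ, Matrix.mul_diagonal, Matrix.diagonal_mul, Matrix.conjTranspose_apply]
  ring

/-- If `W` commutes with the flip of qubit `j`, only `Z` contributes to the local fidelity: the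
channel on qubit `j` is a mixture of the identity and the bit flip. -/
theorem localFidelity_of_flip_invariant {n : ℕ} (U V : QOp n) (j : Fin n) {W : QOp n}
    (hW : W = U * V.conjTranspose) (hU : W * W.conjTranspose = 1)
    (hf : ∀ x y, W (flipBit j x) (flipBit j y) = W x y) :
    localFidelity U V j = 1 / 2 + 1 / 2 ^ (n + 1) *
      (Matrix.trace (pauliZ j * W * pauliZ j * W.conjTranspose)).re := by
  have h := trace_mul_conjTranspose W
  rw [hU, trace_one_qop] at h
  have : (∑ x, ∑ y, if x j = y j then
      W x y * star (W x y + W (flipBit j x) (flipBit j y)) else 0) =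
      2 ^ n + Matrix.trace (pauliZ j * W * pauliZ j * W.conjTranspose) := by
    rw [h, trace_pauliZ_conj, ← Finset.sum_add_distrib]
    refine Finset.sum_congr rfl fun x _ => ?_
    rw [← Finset.sum_add_distrib]
    refine Finset.sum_congr rfl fun y _ => ?_
    rw [hf, bitSign_mul_bitSign, star_add]
    split_ifs <;> ring
  rw [localFidelity_eq U V j hW, this, Complex.add_re]
  have e : ((2 : ℂ) ^ n).re = 2 ^ n := by
    rw [show (2 : ℂ) ^ n = (((2 : ℝ) ^ n : ℝ) : ℂ) by push_cast; rfl, Complex.ofReal_re]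
  rw [e, mul_add, pow_succ]
  congr 1
  field_simp

theorem trace_pauliZ {n : ℕ} (j : Fin n) : Matrix.trace (pauliZ j) = 0 := by
  have h : ∑ x : Fin n → Bool, bitSign (x j) = -∑ x : Fin n → Bool, bitSign (x j) := by
    conv_lhs => rw [← Equiv.sum_comp (flipBit j)]
    rw [← Finset.sum_neg_distrib]
    refine Finset.sum_congr rfl fun x _ => ?_
    cases hx : x j <;> simp [flipBit_apply, bitSign, hx]
  have : Matrix.trace (pauliZ j) = ∑ x : Fin n → Bool, bitSign (x j) := by
    simp [pauliZ, Matrix.trace]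
  rw [this]
  linear_combination (1 / 2 : ℂ) * h

/-- The terms linear in `Z` vanish because `Z` is traceless. -/
theorem acceptProb_eq {m : ℕ} (Q : Circuit (m + 1)) :
    acceptProb Q = 1 / 2 + 1 / 2 ^ (m + 2) *
      (Matrix.trace (pauliZ 0 * Q.toOp * pauliZ 0 * Q.toOp.conjTranspose)).re := by
  have hc : cleanProj m = (1 / 2 : ℂ) • (1 + pauliZ 0) := by
    ext x y
    rw [cleanProj, pauliZ, Matrix.smul_apply, Matrix.add_apply, Matrix.one_apply,
      Matrix.diagonal_apply, Matrix.diagonal_apply]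
    by_cases hxy : x = y
    · subst hxy
      cases hx : x 0 <;> simp [bitSign]
      norm_num
    · simp [hxy]
  have hQ := Circuit.toOp_mul_conjTranspose Q
  set A := Circuit.toOp Q
  have hQ' : A.conjTranspose * A = 1 := mul_eq_one_comm.mp hQ
  have ht : Matrix.trace (cleanProj m * A * cleanState m * A.conjTranspose) =
      ((1 / 2 ^ (m + 2) : ℝ) : ℂ) * (((2 ^ (m + 1) : ℝ) : ℂ) +
        Matrix.trace (pauliZ 0 * A * pauliZ 0 * A.conjTranspose)) := by
    have h1 : Matrix.trace (pauliZ 0 * A * A.conjTranspose) = 0 := by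
      rw [Matrix.mul_assoc, hQ, Matrix.mul_one, trace_pauliZ]
    have h2 : Matrix.trace (A * pauliZ 0 * A.conjTranspose) = 0 := by
      rw [Matrix.trace_mul_comm, ← Matrix.mul_assoc, hQ', Matrix.one_mul, trace_pauliZ]
    simp only [cleanState, hc, Matrix.mul_smul, Matrix.smul_mul, Matrix.trace_smul, add_mul,
      mul_add, Matrix.one_mul, Matrix.mul_one, Matrix.trace_add, h1, h2, hQ, trace_one_qop,
      smul_eq_mul]
    push_cast
    rw [pow_add]
    ring
  rw [acceptProb, ht, Complex.re_ofReal_mul, Complex.add_re, Complex.ofReal_re, mul_add,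
    pow_succ _ (m + 1)]
  congr 1
  field_simp

/-! ### Adding idle qubits to a circuit -/

/-- `M ⊗ 1` on `n + N` qubits. -/
def liftOp {n : ℕ} (N : ℕ) (M : QOp n) : QOp (n + N) :=
  (Matrix.kronecker M (1 : QOp N)).submatrix (Fin.appendEquiv n N).symm (Fin.appendEquiv n N).symm

theorem liftOp_apply {n N : ℕ} (M : QOp n) (x y : Fin (n + N) → Bool) :
    liftOp N M x y = if ∀ k : Fin N, x (Fin.natAdd n k) = y (Fin.natAdd n k) then
      M (fun i => x (Fin.castAdd N i)) (fun i => y (Fin.castAdd N i)) else 0 := by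
  simp [liftOp, Fin.appendEquiv, Matrix.kroneckerMap_apply, Matrix.one_apply, funext_iff]

theorem liftOp_mul {n N : ℕ} (A B : QOp n) : liftOp N (A * B) = liftOp N A * liftOp N B := by
  rw [liftOp, liftOp, liftOp, Matrix.submatrix_mul_equiv]
  congr 1
  have := Matrix.mul_kronecker_mul A B (1 : QOp N) (1 : QOp N)
  rwa [Matrix.mul_one] at this

theorem liftOp_one {n N : ℕ} : liftOp N (1 : QOp n) = 1 := by
  rw [liftOp]
  have : Matrix.kronecker (1 : QOp n) (1 : QOp N) = 1 := Matrix.one_kronecker_one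
  rw [this, Matrix.submatrix_one_equiv]

theorem liftOp_conjTranspose {n N : ℕ} (A : QOp n) :
    (liftOp N A).conjTranspose = liftOp N A.conjTranspose := by
  ext x y
  simp only [liftOp_apply, Matrix.conjTranspose_apply, eq_comm (a := x _) (b := y _)]
  split_ifs <;> simp

theorem trace_liftOp {n N : ℕ} (A : QOp n) :
    Matrix.trace (liftOp N A) = 2 ^ N * Matrix.trace A := by
  have h : Matrix.trace (liftOp N A) = Matrix.trace (Matrix.kronecker A (1 : QOp N)) := by
    rw [liftOp]
    exact Equiv.sum_comp (Fin.appendEquiv n N).symm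
      fun p => Matrix.kronecker A (1 : QOp N) p p
  rw [h, mul_comm]
  exact (Matrix.trace_kronecker A (1 : QOp N)).trans (by rw [trace_one_qop])

theorem liftOp_pauliZ {n N : ℕ} (i : Fin n) :
    liftOp N (pauliZ i) = pauliZ (Fin.castAdd N i) := by
  ext x y
  rw [liftOp_apply]
  have : x = y ↔ (∀ k : Fin N, x (Fin.natAdd n k) = y (Fin.natAdd n k)) ∧
      ∀ k : Fin n, x (Fin.castAdd N k) = y (Fin.castAdd N k) := by
    rw [funext_iff, Fin.forall_fin_add, and_comm]
  simp only [pauliZ, Matrix.diagonal_apply, this, funext_iff]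
  split_ifs <;> simp_all

/-- The same gate on a register with `N` further qubits. -/
def Gate.lift {n : ℕ} (N : ℕ) : Gate n → Gate (n + N)
  | .had i => .had (Fin.castAdd N i)
  | .tee i => .tee (Fin.castAdd N i)
  | .teeDag i => .teeDag (Fin.castAdd N i)
  | .cnot c t h => .cnot (Fin.castAdd N c) (Fin.castAdd N t)
      fun e => h (Fin.castAdd_injective n N e)

theorem onQubit_castAdd {n N : ℕ} (i : Fin n) (g : Matrix Bool Bool ℂ) :
    onQubit (Fin.castAdd N i) g = liftOp N (onQubit i g) := by
  ext x y
  rw [liftOp_apply]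
  have h : (∀ k, k ≠ Fin.castAdd N i → x k = y k) ↔
      (∀ k : Fin N, x (Fin.natAdd n k) = y (Fin.natAdd n k)) ∧
      ∀ k : Fin n, k ≠ i → x (Fin.castAdd N k) = y (Fin.castAdd N k) := by
    rw [Fin.forall_fin_add, and_comm]
    refine and_congr (forall_congr' fun k => ?_) (forall_congr' fun k => ?_)
    · have : Fin.natAdd n k ≠ Fin.castAdd N i := by
        intro e; have := congrArg Fin.val e; simp at this; omega
      simp [this]
    · simp [Fin.castAdd_inj]
  simp only [onQubit, h]
  split_ifs <;> simp_all

theorem Gate.toOp_lift {n N : ℕ} (g : Gate n) : (g.lift N).toOp = liftOp N g.toOp := by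
  cases g with
  | had i => exact onQubit_castAdd i _
  | tee i => exact onQubit_castAdd i _
  | teeDag i => exact onQubit_castAdd i _
  | cnot c t h =>
    ext x y
    rw [liftOp_apply]
    have h' : x = cnotFun (Fin.castAdd N c) (Fin.castAdd N t) y ↔
        (∀ k : Fin N, x (Fin.natAdd n k) = y (Fin.natAdd n k)) ∧
        (fun i => x (Fin.castAdd N i)) = cnotFun c t fun i => y (Fin.castAdd N i) := by
      rw [funext_iff, Fin.forall_fin_add, and_comm, funext_iff]
      refine and_congr (forall_congr' fun k => ?_) (forall_congr' fun k => ?_)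
      · have : Fin.natAdd n k ≠ Fin.castAdd N t := by
          intro e; have := congrArg Fin.val e; simp at this; omega
        simp [cnotFun, this]
      · by_cases hk : k = t
        · subst hk; simp [cnotFun]
        · simp [cnotFun, hk, Fin.castAdd_inj]
    simp only [Gate.lift, toOp_cnot, permOp, h']
    split_ifs <;> simp_all

theorem Circuit.toOp_lift {n N : ℕ} (c : Circuit n) :
    Circuit.toOp (c.map (Gate.lift N)) = liftOp N (Circuit.toOp c) := by
  induction c with
  | nil => simp [Circuit.toOp, liftOp_one]
  | cons g c ih => simp only [List.map_cons, Circuit.toOp, ih, Gate.toOp_lift, liftOp_mul]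

theorem liftOp_flipBit {n N : ℕ} (A : QOp n) (j : Fin N) (x y : Fin (n + N) → Bool) :
    liftOp N A (flipBit (Fin.natAdd n j) x) (flipBit (Fin.natAdd n j) y) = liftOp N A x y := by
  have h1 : ∀ (z : Fin (n + N) → Bool) (i : Fin n),
      flipBit (Fin.natAdd n j) z (Fin.castAdd N i) = z (Fin.castAdd N i) := by
    intro z i
    have : Fin.castAdd N i ≠ Fin.natAdd n j := by
      intro e; have := congrArg Fin.val e; simp at this; omega
    simp [flipBit_apply, this]
  have h2 : ∀ k : Fin N, (flipBit (Fin.natAdd n j) x (Fin.natAdd n k) =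
      flipBit (Fin.natAdd n j) y (Fin.natAdd n k)) ↔
      x (Fin.natAdd n k) = y (Fin.natAdd n k) := by
    intro k
    by_cases hk : k = j
    · subst hk; simp [flipBit_apply]
    · simp [flipBit_apply, hk, Fin.natAdd_inj]
  simp only [liftOp_apply, h1, h2]

theorem liftOp_mul_pauliZ {n N : ℕ} (A : QOp n) (j : Fin N) :
    liftOp N A * pauliZ (Fin.natAdd n j) = pauliZ (Fin.natAdd n j) * liftOp N A := by
  ext x y
  rw [pauliZ, Matrix.mul_diagonal, Matrix.diagonal_mul, liftOp_apply]
  split_ifs with h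
  · rw [h j, mul_comm]
  · simp

/-! ### Fanning the clean qubit out to the added qubits -/

/-- `CNOT` gates from the clean qubit to the first `k` of the `N` added qubits. The highest target
comes first, so that a machine writing the code backwards counts upwards. -/
def fanOut (m N : ℕ) : (k : ℕ) → k ≤ N → Circuit (m + 1 + N)
  | 0, _ => []
  | k + 1, h => .cnot (Fin.castAdd N 0) (Fin.natAdd (m + 1) ⟨k, h⟩)
      (fun e => by have := congrArg Fin.val e; simp at this; omega) :: fanOut m N k (by omega)

theorem fanOut_length (m N k : ℕ) (h : k ≤ N) : (fanOut m N k h).length = k := by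
  induction k with
  | zero => rfl
  | succ k ih => simp [fanOut, ih]

/-- The action of `fanOut` on the computational basis. -/
def fanOutFun (m N k : ℕ) (y : Fin (m + 1 + N) → Bool) : Fin (m + 1 + N) → Bool :=
  Fin.append (fun i => y (Fin.castAdd N i)) fun i =>
    if (i : ℕ) < k then xor (y (Fin.castAdd N 0)) (y (Fin.natAdd (m + 1) i))
    else y (Fin.natAdd (m + 1) i)

theorem toOp_fanOut (m N k : ℕ) (h : k ≤ N) :
    Circuit.toOp (fanOut m N k h) = permOp (fanOutFun m N k) := by
  induction k with
  | zero =>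
    have : fanOutFun m N 0 = id := by
      ext y i
      induction i using Fin.addCases <;> simp [fanOutFun]
    rw [this, permOp_id]; rfl
  | succ k ih =>
    rw [fanOut, Circuit.toOp, ih, toOp_cnot, permOp_mul]
    congr 1
    ext y i
    obtain ⟨p, hp, hpk⟩ : ∃ p : Fin N, (⟨k, h⟩ : Fin N) = p ∧ (p : ℕ) = k := ⟨_, rfl, rfl⟩
    rw [hp]
    have h0 : ∀ i : Fin (m + 1), Fin.castAdd N i ≠ Fin.natAdd (m + 1) p := by
      intro i e; have := congrArg Fin.val e; simp at this; omega
    induction i using Fin.addCases with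
    | left i => simp [fanOutFun, cnotFun, h0]
    | right i =>
      by_cases hi : i = p
      · subst hi; simp [fanOutFun, cnotFun, hpk]
      · have : (i : ℕ) ≠ k := fun e => hi (Fin.ext (e.trans hpk.symm))
        have : (i : ℕ) < k ↔ (i : ℕ) < k + 1 := by omega
        simp [fanOutFun, cnotFun, h0, hi, this, Fin.natAdd_inj]

theorem fanOutFun_involutive (m N : ℕ) : Function.Involutive (fanOutFun m N N) := by
  intro y
  ext i
  induction i using Fin.addCases <;> simp [fanOutFun]

theorem fanOutFun_flipBit (m N : ℕ) (j : Fin N) (y : Fin (m + 1 + N) → Bool) :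
    fanOutFun m N N (flipBit (Fin.natAdd (m + 1) j) y) =
      flipBit (Fin.natAdd (m + 1) j) (fanOutFun m N N y) := by
  have h0 : ∀ i : Fin (m + 1), Fin.castAdd N i ≠ Fin.natAdd (m + 1) j := by
    intro i e; have := congrArg Fin.val e; simp at this; omega
  ext i
  induction i using Fin.addCases with
  | left i => simp [fanOutFun, flipBit_apply, h0]
  | right i =>
    by_cases hi : i = j
    · subst hi; simp [fanOutFun, flipBit_apply, h0]
    · simp [fanOutFun, flipBit_apply, h0, hi, Fin.natAdd_inj]

theorem fanOut_flipBit (m N : ℕ) (j : Fin N) (x y : Fin (m + 1 + N) → Bool) :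
    permOp (fanOutFun m N N) (flipBit (Fin.natAdd (m + 1) j) x)
      (flipBit (Fin.natAdd (m + 1) j) y) = permOp (fanOutFun m N N) x y := by
  simp [permOp, fanOutFun_flipBit]

/-- Conjugation by the fan-out maps `Z` on an added qubit to `Z ⊗ Z`. -/
theorem fanOut_mul_pauliZ (m N : ℕ) (j : Fin N) :
    permOp (fanOutFun m N N) * pauliZ (Fin.natAdd (m + 1) j) =
      pauliZ (Fin.castAdd N 0) * pauliZ (Fin.natAdd (m + 1) j) * permOp (fanOutFun m N N) := by
  ext x y
  rw [pauliZ, pauliZ, Matrix.diagonal_mul_diagonal, Matrix.mul_diagonal, Matrix.diagonal_mul,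
    permOp]
  split_ifs with h
  · subst h
    cases h0 : y (Fin.castAdd N 0) <;> cases h1 : y (Fin.natAdd (m + 1) j) <;>
      simp [fanOutFun, bitSign, h0, h1]
  · simp

theorem mul_flipBit_invariant {n : ℕ} {j : Fin n} {A B : QOp n}
    (hA : ∀ x y, A (flipBit j x) (flipBit j y) = A x y)
    (hB : ∀ x y, B (flipBit j x) (flipBit j y) = B x y) (x y : Fin n → Bool) :
    (A * B) (flipBit j x) (flipBit j y) = (A * B) x y := by
  rw [Matrix.mul_apply, Matrix.mul_apply, ← Equiv.sum_comp (flipBit j)]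
  simp only [hA, hB]

/-! ### The cost of the pair of circuits -/

/-- The circuit `Q`, followed by the fan-out. -/
def fanAfter {m : ℕ} (N : ℕ) (Q : Circuit (m + 1)) : Circuit (m + 1 + N) :=
  Q.map (Gate.lift N) ++ fanOut m N N le_rfl

/-- The circuit `Q`, preceded by the fan-out. -/
def fanBefore {m : ℕ} (N : ℕ) (Q : Circuit (m + 1)) : Circuit (m + 1 + N) :=
  fanOut m N N le_rfl ++ Q.map (Gate.lift N)

/-- The channel on an added qubit is a bit flip whose probability is the rejection probability
of `Q`. -/
theorem localFidelity_fan {m : ℕ} (N : ℕ) (Q : Circuit (m + 1)) (j : Fin N) :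
    localFidelity (fanAfter N Q).toOp (fanBefore N Q).toOp (Fin.natAdd (m + 1) j) =
      acceptProb Q := by
  set C : QOp (m + 1 + N) := permOp (fanOutFun m N N) with hC
  set A := liftOp N (Circuit.toOp Q) with hA
  set Zj : QOp (m + 1 + N) := pauliZ (Fin.natAdd (m + 1) j) with hZj
  set Z0 : QOp (m + 1 + N) := pauliZ (Fin.castAdd N 0) with hZ0
  have hCC : C * C = 1 := by
    rw [hC, permOp_mul, (fanOutFun_involutive m N).comp_self, permOp_id]
  have hCt : C.conjTranspose = C := permOp_conjTranspose (fanOutFun_involutive m N)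
  have hQ := Circuit.toOp_mul_conjTranspose Q
  have hAA : A * A.conjTranspose = 1 := by
    rw [hA, liftOp_conjTranspose, ← liftOp_mul, hQ, liftOp_one]
  have hAA' : A.conjTranspose * A = 1 := mul_eq_one_comm.mp hAA
  have hW : C * A * C * A.conjTranspose =
      (fanAfter N Q).toOp * (fanBefore N Q).toOp.conjTranspose := by
    rw [fanAfter, fanBefore, Circuit.toOp_append, Circuit.toOp_append, Circuit.toOp_lift,
      toOp_fanOut, ← hA, ← hC, Matrix.conjTranspose_mul, hCt]
    simp only [Matrix.mul_assoc]
  have hWt : (C * A * C * A.conjTranspose).conjTranspose = A * C * A.conjTranspose * C := by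
    simp only [Matrix.conjTranspose_mul, Matrix.conjTranspose_conjTranspose, hCt, Matrix.mul_assoc]
  have hU : C * A * C * A.conjTranspose * (C * A * C * A.conjTranspose).conjTranspose = 1 := by
    rw [hWt]
    calc C * A * C * A.conjTranspose * (A * C * A.conjTranspose * C) =
        C * A * C * (A.conjTranspose * A) * C * A.conjTranspose * C := by
          simp only [Matrix.mul_assoc]
      _ = C * A * (C * C) * A.conjTranspose * C := by
          rw [hAA', Matrix.mul_one]; simp only [Matrix.mul_assoc]
      _ = C * (A * A.conjTranspose) * C := by
          rw [hCC, Matrix.mul_one]; simp only [Matrix.mul_assoc]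
      _ = 1 := by rw [hAA, Matrix.mul_one, hCC]
  have hf : ∀ x y, (C * A * C * A.conjTranspose) (flipBit (Fin.natAdd (m + 1) j) x)
      (flipBit (Fin.natAdd (m + 1) j) y) = (C * A * C * A.conjTranspose) x y := by
    have h1 := fanOut_flipBit m N j
    refine mul_flipBit_invariant (mul_flipBit_invariant
      (mul_flipBit_invariant h1 (liftOp_flipBit _ j)) h1) ?_
    rw [hA, liftOp_conjTranspose]
    exact liftOp_flipBit _ j
  have hCZ : C * Zj = Z0 * Zj * C := fanOut_mul_pauliZ m N j
  have hCZC : C * Zj * C = Z0 * Zj := by rw [hCZ, Matrix.mul_assoc, hCC, Matrix.mul_one]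
  have hAtZ : A.conjTranspose * Zj = Zj * A.conjTranspose := by
    rw [hA, liftOp_conjTranspose]; exact liftOp_mul_pauliZ _ j
  have hZA : A * Zj = Zj * A := liftOp_mul_pauliZ _ j
  have hZZ : Zj * Zj = 1 := pauliZ_mul_self _
  have hZc : Z0 * Zj = Zj * Z0 := by
    rw [hZ0, hZj, pauliZ, pauliZ, Matrix.diagonal_mul_diagonal, Matrix.diagonal_mul_diagonal]
    simp only [mul_comm]
  have ht : Matrix.trace (Zj * (C * A * C * A.conjTranspose) * Zj *
      (C * A * C * A.conjTranspose).conjTranspose) =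
      Matrix.trace (Z0 * A * Z0 * A.conjTranspose) := by
    rw [hWt]
    calc Matrix.trace (Zj * (C * A * C * A.conjTranspose) * Zj * (A * C * A.conjTranspose * C))
        = Matrix.trace (Zj * C * A * C * (A.conjTranspose * Zj) * A * C * A.conjTranspose * C) := by
          simp only [Matrix.mul_assoc]
      _ = Matrix.trace (Zj * C * A * (C * Zj * (A.conjTranspose * A) * C) *
            A.conjTranspose * C) := by
          rw [hAtZ]; simp only [Matrix.mul_assoc]
      _ = Matrix.trace (Zj * C * A * (Zj * Z0) * A.conjTranspose * C) := by
          rw [hAA', Matrix.mul_one, hCZC, hZc]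
      _ = Matrix.trace (C * (Zj * C * A * (Zj * Z0) * A.conjTranspose)) :=
          Matrix.trace_mul_comm _ _
      _ = Matrix.trace ((C * Zj * C) * (A * Zj) * Z0 * A.conjTranspose) := by
          simp only [Matrix.mul_assoc]
      _ = Matrix.trace (Z0 * (Zj * Zj) * A * Z0 * A.conjTranspose) := by
          rw [hCZC, hZA]; simp only [Matrix.mul_assoc]
      _ = _ := by rw [hZZ, Matrix.mul_one]
  have hl : Matrix.trace (Z0 * A * Z0 * A.conjTranspose) = ((2 ^ N : ℝ) : ℂ) *
      Matrix.trace (pauliZ 0 * Q.toOp * pauliZ 0 * Q.toOp.conjTranspose) := by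
    rw [hZ0, hA, ← liftOp_pauliZ, liftOp_conjTranspose, ← liftOp_mul, ← liftOp_mul, ← liftOp_mul,
      trace_liftOp]
    push_cast; rfl
  rw [localFidelity_of_flip_invariant _ _ _ hW hU hf, ht, hl, Complex.re_ofReal_mul, acceptProb_eq,
    ← mul_assoc, show m + 1 + N + 1 = (m + 2) + N by ring, pow_add _ (m + 2) N]
  congr 2
  field_simp

/-- Up to the contribution of the qubits of `Q`, the cost is the rejection probability of `Q`. -/
theorem costLHST_fan_mem_Icc {m : ℕ} (N : ℕ) (Q : Circuit (m + 1)) :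
    ((m + 1 + N : ℕ) : ℝ) * costLHST (fanAfter N Q).toOp (fanBefore N Q).toOp ∈
      Set.Icc (N * (1 - acceptProb Q)) (N * (1 - acceptProb Q) + 2 * (m + 1)) := by
  have hn : ((m + 1 + N : ℕ) : ℝ) ≠ 0 := by positivity
  have hU : (fanAfter N Q).toOp * (fanBefore N Q).toOp.conjTranspose *
      ((fanAfter N Q).toOp * (fanBefore N Q).toOp.conjTranspose).conjTranspose = 1 := by
    have h1 := Circuit.toOp_mul_conjTranspose (fanAfter N Q)
    have h2 := mul_eq_one_comm.mp (Circuit.toOp_mul_conjTranspose (fanBefore N Q))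
    rw [Matrix.conjTranspose_mul, Matrix.conjTranspose_conjTranspose, Matrix.mul_assoc,
      ← Matrix.mul_assoc _ (fanBefore N Q).toOp, h2, Matrix.one_mul, h1]
  have hb := fun j => abs_le.mp (abs_localFidelity_le_one _ _ j hU)
  rw [costLHST, ← mul_assoc, mul_one_div_cancel hn, one_mul, Fin.sum_univ_add]
  simp only [localFidelity_fan, Finset.sum_const, Finset.card_univ, Fintype.card_fin,
    nsmul_eq_mul]
  constructor
  · have : 0 ≤ ∑ i : Fin (m + 1), (1 - localFidelity (fanAfter N Q).toOp
        (fanBefore N Q).toOp (Fin.castAdd N i)) :=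
      Finset.sum_nonneg fun i _ => by linarith [(hb (Fin.castAdd N i)).2]
    linarith
  · have : ∑ i : Fin (m + 1), (1 - localFidelity (fanAfter N Q).toOp
        (fanBefore N Q).toOp (Fin.castAdd N i)) ≤ ∑ i : Fin (m + 1), (2 : ℝ) :=
      Finset.sum_le_sum fun i _ => by linarith [(hb (Fin.castAdd N i)).1]
    simp only [Finset.sum_const, Finset.card_univ, Fintype.card_fin, nsmul_eq_mul] at this
    push_cast at this
    linarith

/-! ### Running programs -/

/-- With oracle `O` and initial store `s`, the program `P` halts within `T` steps with
store `s'`. -/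
def Prog.Does (O : List Bool → List Bool) (P : Prog) (s : Store) (T : ℕ) (s' : Store) : Prop :=
  ∃ t ≤ T, P.Runs O s t s'

namespace Prog

variable {O : List Bool → List Bool} {P Q R : Prog} {s s' s'' : Store} {T T' r : ℕ}

theorem Does.mono (h : P.Does O s T s') (hT : T ≤ T') : P.Does O s T' s' := by
  obtain ⟨t, ht, h⟩ := h
  exact ⟨t, ht.trans hT, h⟩

theorem Does.to (h : P.Does O s T s') (hs : s' = s'') : P.Does O s T s'' := hs ▸ h

theorem does_push (r : ℕ) (b : Bool) :
    (Prog.push r b).Does O s 1 (Function.update s r (b :: s r)) :=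
  ⟨1, le_rfl, .push r b s⟩

theorem does_pop (r : ℕ) : (Prog.pop r).Does O s 1 (Function.update s r (s r).tail) :=
  ⟨1, le_rfl, .pop r s⟩

theorem does_query (q a : ℕ) :
    (Prog.query q a).Does O s ((s q).length + 1) (Function.update s a (O (s q))) :=
  ⟨_, le_rfl, .query q a s⟩

theorem Does.seq (h : P.Does O s T s') (h' : Q.Does O s' T' s'') :
    (Prog.seq P Q).Does O s (T + T') s'' := by
  obtain ⟨t, ht, h⟩ := h
  obtain ⟨t', ht', h'⟩ := h'
  exact ⟨t + t', by omega, .seq h h'⟩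

theorem Does.branch_nil (hr : s r = []) (h : P.Does O s T s') :
    (Prog.branch r P Q R).Does O s (T + 1) s' := by
  obtain ⟨t, ht, h⟩ := h
  exact ⟨t + 1, by omega, .branch_nil hr h⟩

theorem Does.branch_false (hr : (s r).head? = some false) (h : Q.Does O s T s') :
    (Prog.branch r P Q R).Does O s (T + 1) s' := by
  obtain ⟨t, ht, h⟩ := h
  exact ⟨t + 1, by omega, .branch_false hr h⟩

theorem Does.branch_true (hr : (s r).head? = some true) (h : R.Does O s T s') :
    (Prog.branch r P Q R).Does O s (T + 1) s' := by
  obtain ⟨t, ht, h⟩ := h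
  exact ⟨t + 1, by omega, .branch_true hr h⟩

theorem does_loop_done (hr : s r = []) : (Prog.loop r P).Does O s 1 s :=
  ⟨1, le_rfl, .loop_done hr⟩

theorem Does.loop_step (hr : s r ≠ []) (h : P.Does O s T s')
    (h' : (Prog.loop r P).Does O s' T' s'') : (Prog.loop r P).Does O s (T + T' + 1) s'' := by
  obtain ⟨t, ht, h⟩ := h
  obtain ⟨t', ht', h'⟩ := h'
  exact ⟨t + t' + 1, by omega, .loop_step hr h h'⟩

/-- Without oracle calls a stack grows by at most one symbol per step. This bounds the size of the
circuit computed by a polynomial-time program. -/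
theorem Runs.length_le {t : ℕ} (h : P.Runs O s t s') (hP : P.QueryFree) (r : ℕ) :
    (s' r).length ≤ (s r).length + t := by
  induction h with
  | skip s => omega
  | push r' b s =>
    by_cases hr : r = r'
    · subst hr; simp
    · simp [hr]
  | pop r' s =>
    by_cases hr : r = r'
    · subst hr; simp; omega
    · simp [hr]
  | seq _ _ ih ih' => have := ih hP.1; have := ih' hP.2; omega
  | branch_nil _ _ ih => have := ih hP.1; omega
  | branch_false _ _ ih => have := ih hP.2.1; omega
  | branch_true _ _ ih => have := ih hP.2.2; omega
  | loop_done _ => omega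
  | loop_step _ _ _ ih ih' => have := ih hP; have := ih' hP; omega
  | query => exact hP.elim

/-! ### Draining a stack -/

/-- Push `b` on the stacks `ds`, then continue with `P`. -/
def pushes (b : Bool) : List ℕ → Prog → Prog
  | [], P => P
  | d :: ds, P => .seq (.push d b) (pushes b ds P)

theorem Does.pushes {b : Bool} {ds : List ℕ} (hd : ds.Nodup)
    (h : P.Does O (fun i => if i ∈ ds then b :: s i else s i) T s') :
    (pushes b ds P).Does O s (T + ds.length) s' := by
  induction ds generalizing s with
  | nil => simpa [Prog.pushes] using h
  | cons d ds ih =>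
    rw [List.nodup_cons] at hd
    refine ((does_push d b).seq (ih hd.2 ?_)).mono
      (T := 1 + (T + ds.length)) (by simp; omega)
    convert h using 1
    funext i
    by_cases hi : i = d
    · subst hi; simp [hd.1]
    · simp [hi]

/-- Move the contents of stack `r` onto the stacks `ds`, pushing a `true` on the stacks `us` for
each bit. -/
def drain (r : ℕ) (ds us : List ℕ) : Prog :=
  .loop r (.branch r .skip
    (.seq (.pop r) (pushes false ds (pushes true us .skip)))
    (.seq (.pop r) (pushes true ds (pushes true us .skip))))

theorem does_drain {r : ℕ} {ds us : List ℕ} (hr : r ∉ ds ∧ r ∉ us) (hd : ds.Nodup)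
    (hu : us.Nodup) (hdu : ∀ i ∈ us, i ∉ ds) :
    (drain r ds us).Does O s ((s r).length * (ds.length + us.length + 4) + 1)
      (fun i => if i = r then [] else if i ∈ ds then (s r).reverse ++ s i
        else if i ∈ us then List.replicate (s r).length true ++ s i else s i) := by
  generalize hl : s r = l
  induction l generalizing s with
  | nil =>
    refine ((does_loop_done hl).to ?_).mono (by simp)
    funext i
    by_cases hi : i = r
    · subst hi; simp [hl]
    · simp [hi]
  | cons b l ih =>
    set s₁ : Store := fun i => if i = r then l else if i ∈ ds then b :: s i
      else if i ∈ us then true :: s i else s i with hs₁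
    have hbody : (Prog.branch r .skip
        (.seq (.pop r) (Prog.pushes false ds (Prog.pushes true us .skip)))
        (.seq (.pop r) (Prog.pushes true ds (Prog.pushes true us .skip)))).Does O s
        (1 + ((1 + us.length) + ds.length) + 1) s₁ := by
      have key : (Prog.seq (.pop r) (Prog.pushes b ds (Prog.pushes true us .skip))).Does O s
          (1 + ((1 + us.length) + ds.length)) s₁ := by
        refine (does_pop r).seq (Does.pushes hd (Does.pushes hu ⟨1, le_rfl, ?_⟩))
        convert Prog.Runs.skip _ using 1
        funext i
        by_cases hi : i = r
        · subst hi; simp [hs₁, hr.1, hr.2, hl]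
        · by_cases hid : i ∈ ds
          · have : i ∉ us := fun h => hdu i h hid
            simp [hs₁, hi, hid, this]
          · simp [hs₁, hi, hid]
      cases b
      · exact Does.branch_false (by simp [hl]) key
      · exact Does.branch_true (by simp [hl]) key
    refine ((hbody.loop_step (by simp [hl]) (ih (s := s₁) (by simp [hs₁]))).to ?_).mono ?_
    · funext i
      by_cases hi : i = r
      · simp [hi]
      · by_cases hid : i ∈ ds
        · simp [hs₁, hi, hid]
        · by_cases hiu : i ∈ us
          · simp [hs₁, hi, hid, hiu, List.replicate_succ']
          · simp [hs₁, hi, hid, hiu]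
    · simp only [List.length_cons, add_mul, one_mul]
      omega

end Prog

/-! ### Eight registers on top of a given program -/

/-- The store with given contents of the first eight stacks, the remaining stacks holding `u`. -/
def regs (a₀ a₁ a₂ a₃ a₄ a₅ a₆ a₇ : List Bool) (u : Store) : Store
  | 0 => a₀
  | 1 => a₁
  | 2 => a₂
  | 3 => a₃
  | 4 => a₄
  | 5 => a₅
  | 6 => a₆
  | 7 => a₇
  | r + 8 => u r

section regs

variable (a₀ a₁ a₂ a₃ a₄ a₅ a₆ a₇ v : List Bool) (u : Store)

@[simp] theorem regs_apply₀ : regs a₀ a₁ a₂ a₃ a₄ a₅ a₆ a₇ u 0 = a₀ := rfl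
@[simp] theorem regs_apply₁ : regs a₀ a₁ a₂ a₃ a₄ a₅ a₆ a₇ u 1 = a₁ := rfl
@[simp] theorem regs_apply₂ : regs a₀ a₁ a₂ a₃ a₄ a₅ a₆ a₇ u 2 = a₂ := rfl
@[simp] theorem regs_apply₃ : regs a₀ a₁ a₂ a₃ a₄ a₅ a₆ a₇ u 3 = a₃ := rfl
@[simp] theorem regs_apply₄ : regs a₀ a₁ a₂ a₃ a₄ a₅ a₆ a₇ u 4 = a₄ := rfl
@[simp] theorem regs_apply₅ : regs a₀ a₁ a₂ a₃ a₄ a₅ a₆ a₇ u 5 = a₅ := rfl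
@[simp] theorem regs_apply₆ : regs a₀ a₁ a₂ a₃ a₄ a₅ a₆ a₇ u 6 = a₆ := rfl
@[simp] theorem regs_apply₇ : regs a₀ a₁ a₂ a₃ a₄ a₅ a₆ a₇ u 7 = a₇ := rfl
@[simp] theorem regs_apply₉ : regs a₀ a₁ a₂ a₃ a₄ a₅ a₆ a₇ u 9 = u 1 := rfl
@[simp] theorem regs_apply_add (r : ℕ) : regs a₀ a₁ a₂ a₃ a₄ a₅ a₆ a₇ u (r + 8) = u r := rfl

theorem store_ext {s s' : Store} (h₀ : s 0 = s' 0) (h₁ : s 1 = s' 1) (h₂ : s 2 = s' 2)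
    (h₃ : s 3 = s' 3) (h₄ : s 4 = s' 4) (h₅ : s 5 = s' 5) (h₆ : s 6 = s' 6) (h₇ : s 7 = s' 7)
    (h : ∀ r, s (r + 8) = s' (r + 8)) : s = s' := by
  funext i
  match i with
  | 0 => exact h₀
  | 1 => exact h₁
  | 2 => exact h₂
  | 3 => exact h₃
  | 4 => exact h₄
  | 5 => exact h₅
  | 6 => exact h₆
  | 7 => exact h₇
  | r + 8 => exact h r

theorem update_regs_add (r : ℕ) : Function.update (regs a₀ a₁ a₂ a₃ a₄ a₅ a₆ a₇ u) (r + 8) v =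
    regs a₀ a₁ a₂ a₃ a₄ a₅ a₆ a₇ (Function.update u r v) := by
  apply store_ext <;> simp [Function.update_apply]

@[simp] theorem update_regs₀ : Function.update (regs a₀ a₁ a₂ a₃ a₄ a₅ a₆ a₇ u) 0 v =
    regs v a₁ a₂ a₃ a₄ a₅ a₆ a₇ u := by
  apply store_ext <;> simp
@[simp] theorem update_regs₁ : Function.update (regs a₀ a₁ a₂ a₃ a₄ a₅ a₆ a₇ u) 1 v =
    regs a₀ v a₂ a₃ a₄ a₅ a₆ a₇ u := by
  apply store_ext <;> simp
@[simp] theorem update_regs₂ : Function.update (regs a₀ a₁ a₂ a₃ a₄ a₅ a₆ a₇ u) 2 v =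
    regs a₀ a₁ v a₃ a₄ a₅ a₆ a₇ u := by
  apply store_ext <;> simp
@[simp] theorem update_regs₃ : Function.update (regs a₀ a₁ a₂ a₃ a₄ a₅ a₆ a₇ u) 3 v =
    regs a₀ a₁ a₂ v a₄ a₅ a₆ a₇ u := by
  apply store_ext <;> simp
@[simp] theorem update_regs₄ : Function.update (regs a₀ a₁ a₂ a₃ a₄ a₅ a₆ a₇ u) 4 v =
    regs a₀ a₁ a₂ a₃ v a₅ a₆ a₇ u := by
  apply store_ext <;> simp
@[simp] theorem update_regs₆ : Function.update (regs a₀ a₁ a₂ a₃ a₄ a₅ a₆ a₇ u) 6 v =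
    regs a₀ a₁ a₂ a₃ a₄ a₅ v a₇ u := by
  apply store_ext <;> simp
@[simp] theorem update_regs₇ : Function.update (regs a₀ a₁ a₂ a₃ a₄ a₅ a₆ a₇ u) 7 v =
    regs a₀ a₁ a₂ a₃ a₄ a₅ a₆ v u := by
  apply store_ext <;> simp
@[simp] theorem update_regs₉ : Function.update (regs a₀ a₁ a₂ a₃ a₄ a₅ a₆ a₇ u) 9 v =
    regs a₀ a₁ a₂ a₃ a₄ a₅ a₆ a₇ (Function.update u 1 v) :=
  update_regs_add a₀ a₁ a₂ a₃ a₄ a₅ a₆ a₇ v u 1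

end regs

namespace Prog

/-- The program acting on the stacks from number `8` on. -/
def shift : Prog → Prog
  | .skip => .skip
  | .push r b => .push (r + 8) b
  | .pop r => .pop (r + 8)
  | .seq P Q => .seq P.shift Q.shift
  | .branch r P Q R => .branch (r + 8) P.shift Q.shift R.shift
  | .loop r P => .loop (r + 8) P.shift
  | .query q a => .query (q + 8) (a + 8)

/-- The shifted program works next to arbitrary contents of the first eight stacks. In the absence
of oracle calls the oracle may be exchanged. -/
theorem Runs.shift {O O' : List Bool → List Bool} {P : Prog} {s s' : Store} {t : ℕ}
    (h : P.Runs O s t s') (hP : P.QueryFree) (a₀ a₁ a₂ a₃ a₄ a₅ a₆ a₇ : List Bool) :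
    P.shift.Runs O' (regs a₀ a₁ a₂ a₃ a₄ a₅ a₆ a₇ s) t (regs a₀ a₁ a₂ a₃ a₄ a₅ a₆ a₇ s') := by
  induction h with
  | skip s => exact .skip _
  | push r b s => rw [← update_regs_add]; exact .push _ _ _
  | pop r s => rw [← update_regs_add]; exact .pop _ _
  | seq _ _ ih ih' => exact .seq (ih hP.1) (ih' hP.2)
  | branch_nil h _ ih => exact .branch_nil h (ih hP.1)
  | branch_false h _ ih => exact .branch_false h (ih hP.2.1)
  | branch_true h _ ih => exact .branch_true h (ih hP.2.2)
  | loop_done h => exact .loop_done h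
  | loop_step h _ _ ih ih' => exact .loop_step h (ih hP) (ih' hP)
  | query => exact hP.elim

end Prog

/-! ### The machine that writes the oracle question -/

/-- The code of the gates of `fanOut m N k`, each preceded by `true`. -/
def fanOutCode (m : ℕ) : ℕ → List Bool
  | 0 => []
  | k + 1 => [true, true, true, false] ++ (unaryCode (m + 1 + k) ++ fanOutCode m k)

theorem fanOutCode_length_le (m k : ℕ) : (fanOutCode m k).length ≤ k * (m + k + 6) := by
  induction k with
  | zero => simp [fanOutCode]
  | succ k ih =>
    simp only [fanOutCode, unaryCode, List.length_append, List.length_replicate, List.length_cons,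
      List.length_nil]
    nlinarith

namespace Prog

variable {O : List Bool → List Bool} {a₀ a₁ a₂ a₃ a₄ a₅ a₆ a₇ : List Bool} {u : Store}

/-- The unary number `k` as contents of a stack. -/
local notation "𝟏" k:max => List.replicate k true

/-- Replace the unary number on stack `4` by its product with the one on stack `3`. -/
def mulLoop : Prog :=
  .loop 4 (.seq (.pop 4) (.seq (drain 3 [] [5, 6]) (drain 6 [] [3])))

theorem does_mulLoop (L a b : ℕ) :
    mulLoop.Does O (regs a₀ a₁ a₂ (𝟏 L) (𝟏 a) (𝟏 b) [] a₇ u) (a * (11 * L + 4) + 1)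
      (regs a₀ a₁ a₂ (𝟏 L) [] (𝟏 (b + a * L)) [] a₇ u) := by
  induction a generalizing b with
  | zero => simpa [mulLoop] using does_loop_done (by simp)
  | succ a ih =>
    have h1 : (Prog.pop 4).Does O (regs a₀ a₁ a₂ (𝟏 L) (𝟏 (a + 1)) (𝟏 b) [] a₇ u) 1
        (regs a₀ a₁ a₂ (𝟏 L) (𝟏 a) (𝟏 b) [] a₇ u) := (does_pop 4).to (by simp)
    have h2 : (drain 3 [] [5, 6]).Does O (regs a₀ a₁ a₂ (𝟏 L) (𝟏 a) (𝟏 b) [] a₇ u) (L * 6 + 1)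
        (regs a₀ a₁ a₂ [] (𝟏 a) (𝟏 (L + b)) (𝟏 L) a₇ u) :=
      ((does_drain (by decide) (by decide) (by decide) (by decide)).to
        (by apply store_ext <;> simp)).mono (by simp)
    have h3 : (drain 6 [] [3]).Does O (regs a₀ a₁ a₂ [] (𝟏 a) (𝟏 (L + b)) (𝟏 L) a₇ u) (L * 5 + 1)
        (regs a₀ a₁ a₂ (𝟏 L) (𝟏 a) (𝟏 (L + b)) [] a₇ u) :=
      ((does_drain (by decide) (by decide) (by decide) (by decide)).to
        (by apply store_ext <;> simp)).mono (by simp)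
    refine (((h1.seq (h2.seq h3)).loop_step (by simp) (ih (L + b))).to ?_).mono ?_
    · rw [show L + b + a * L = b + (a + 1) * L by ring]
    · nlinarith

/-- Replace the unary number on stack `4` by its product with the `d`-th power of the one on
stack `3`. -/
def mulPow : ℕ → Prog
  | 0 => .skip
  | d + 1 => .seq (mulPow d) (.seq mulLoop (drain 5 [] [4]))

theorem does_mulPow {L : ℕ} (hL : 1 ≤ L) (d : ℕ) :
    (mulPow d).Does O (regs a₀ a₁ a₂ (𝟏 L) (𝟏 1) [] [] a₇ u) (1 + d * (22 * L ^ d))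
      (regs a₀ a₁ a₂ (𝟏 L) (𝟏 (L ^ d)) [] [] a₇ u) := by
  induction d with
  | zero => exact ⟨1, by omega, .skip _⟩
  | succ d ih =>
    have h1 := does_mulLoop (O := O) (a₀ := a₀) (a₁ := a₁) (a₂ := a₂) (a₇ := a₇) (u := u) L
      (L ^ d) 0
    have h2 : (drain 5 [] [4]).Does O
        (regs a₀ a₁ a₂ (𝟏 L) [] (𝟏 (0 + L ^ d * L)) [] a₇ u) (L ^ (d + 1) * 5 + 1)
        (regs a₀ a₁ a₂ (𝟏 L) (𝟏 (L ^ (d + 1))) [] [] a₇ u) :=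
      ((does_drain (by decide) (by decide) (by decide) (by decide)).to
        (by apply store_ext <;> simp [pow_succ])).mono (by simp [pow_succ])
    refine (ih.seq (h1.seq h2)).mono ?_
    have hp : L ^ d ≤ L ^ (d + 1) := Nat.pow_le_pow_right hL (by omega)
    have h1' : 1 ≤ L ^ (d + 1) := Nat.one_le_pow _ _ hL
    have : d * (22 * L ^ d) ≤ d * (22 * L ^ (d + 1)) := by gcongr
    have e : L ^ d * (11 * L + 4) = 11 * L ^ (d + 1) + 4 * L ^ d := by ring
    rw [e]
    linarith

/-- Push `c` times `true` on stack `r`. -/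
def pushTrues (r : ℕ) : ℕ → Prog
  | 0 => .skip
  | c + 1 => .seq (.push r true) (pushTrues r c)

theorem does_pushTrues (c l : ℕ) :
    (pushTrues 3 c).Does O (regs a₀ a₁ a₂ (𝟏 l) a₄ a₅ a₆ a₇ u) (c + 1)
      (regs a₀ a₁ a₂ (𝟏 (l + c)) a₄ a₅ a₆ a₇ u) := by
  induction c generalizing l with
  | zero => exact ⟨1, by omega, .skip _⟩
  | succ c ih =>
    refine (((does_push 3 true).to ?_).seq ((ih (l + 1)).to ?_)).mono (by omega)
    · simp [List.replicate_succ]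
    · rw [show l + 1 + c = l + (c + 1) by omega]

/-- Put the input on stack `8` and the unary number `(|x| + c) ^ d` on stack `4`. -/
def prepare (c d : ℕ) : Prog :=
  .seq (drain 0 [2] [3]) (.seq (drain 2 [8] []) (.seq (pushTrues 3 c) (.seq (.push 4 true)
    (.seq (mulPow d) (drain 3 [] [])))))

theorem does_prepare {c d : ℕ} (hc : 1 ≤ c) (x : List Bool) :
    (prepare c d).Does O (initStore x)
      (15 * (x.length + c) + d * (22 * (x.length + c) ^ d) + 6)
      (regs [] [] [] [] (𝟏 ((x.length + c) ^ d)) [] [] [] (initStore x)) := by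
  have h0 : initStore x = regs x [] [] [] [] [] [] [] (fun _ => []) := by
    apply store_ext <;> simp [initStore]
  have h1 : (drain 0 [2] [3]).Does O (initStore x)
      (x.length * 6 + 1) (regs [] [] x.reverse (𝟏 x.length) [] [] [] [] (fun _ => [])) := by
    rw [h0]
    exact ((does_drain (by decide) (by decide) (by decide) (by decide)).to
      (by apply store_ext <;> simp)).mono (by simp)
  have h2 : (drain 2 [8] []).Does O
      (regs [] [] x.reverse (𝟏 x.length) [] [] [] [] (fun _ => []))
      (x.length * 5 + 1) (regs [] [] [] (𝟏 x.length) [] [] [] [] (initStore x)) :=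
    ((does_drain (by decide) (by decide) (by decide) (by decide)).to
      (by apply store_ext <;> simp [initStore])).mono (by simp)
  have h3 : (Prog.push 4 true).Does O
      (regs [] [] [] (𝟏 (x.length + c)) [] [] [] [] (initStore x)) 1
      (regs [] [] [] (𝟏 (x.length + c)) (𝟏 1) [] [] [] (initStore x)) :=
    (does_push 4 true).to (by simp)
  have h4 : (drain 3 [] []).Does O
      (regs [] [] [] (𝟏 (x.length + c)) (𝟏 ((x.length + c) ^ d)) [] [] [] (initStore x))
      ((x.length + c) * 4 + 1)
      (regs [] [] [] [] (𝟏 ((x.length + c) ^ d)) [] [] [] (initStore x)) :=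
    ((does_drain (by decide) (by decide) (by decide) (by decide)).to
      (by apply store_ext <;> simp)).mono (by simp)
  refine (h1.seq (h2.seq ((does_pushTrues c x.length).seq
    (h3.seq ((does_mulPow (by omega) d).seq h4))))).mono ?_
  omega

/-- Split the unary code `1 ... 1 0` off stack `9` and put the number on the stacks `2`
and `3`. As a loop stops only at an empty stack, stack `7` holds a flag that is removed when the
final `0` is read. -/
def splitUnary : Prog :=
  .seq (.push 7 true) (.loop 7 (.branch 9 .skip (.seq (.pop 7) (.pop 9))
    (.seq (.pop 9) (.seq (.push 2 true) (.push 3 true)))))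

theorem does_splitUnary (k : ℕ) (rest : List Bool) (hu : u 1 = unaryCode k ++ rest) :
    splitUnary.Does O (regs a₀ a₁ [] [] a₄ a₅ a₆ [] u) (k * 5 + 6)
      (regs a₀ a₁ (𝟏 k) (𝟏 k) a₄ a₅ a₆ [] (Function.update u 1 rest)) := by
  have loop : ∀ (k a : ℕ) (u : Store), u 1 = unaryCode k ++ rest →
      (Prog.loop 7 (.branch 9 .skip (.seq (.pop 7) (.pop 9))
        (.seq (.pop 9) (.seq (.push 2 true) (.push 3 true))))).Does O
        (regs a₀ a₁ (𝟏 a) (𝟏 a) a₄ a₅ a₆ [true] u) (k * 5 + 5)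
        (regs a₀ a₁ (𝟏 (a + k)) (𝟏 (a + k)) a₄ a₅ a₆ [] (Function.update u 1 rest)) := by
    intro k
    induction k with
    | zero =>
      intro a u hu
      have h : ((Prog.pop 7).seq (.pop 9)).Does O (regs a₀ a₁ (𝟏 a) (𝟏 a) a₄ a₅ a₆ [true] u)
          (1 + 1) (regs a₀ a₁ (𝟏 a) (𝟏 a) a₄ a₅ a₆ [] (Function.update u 1 rest)) :=
        ((does_pop 7).seq (does_pop 9)).to (by simp [hu, unaryCode])
      refine (Does.loop_step (by simp) (Does.branch_false ?_ h) (does_loop_done (by simp))).mono ?_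
      · simp [hu, unaryCode]
      · omega
    | succ k ih =>
      intro a u hu
      have h : ((Prog.pop 9).seq (.seq (.push 2 true) (.push 3 true))).Does O
          (regs a₀ a₁ (𝟏 a) (𝟏 a) a₄ a₅ a₆ [true] u) (1 + (1 + 1))
          (regs a₀ a₁ (𝟏 (a + 1)) (𝟏 (a + 1)) a₄ a₅ a₆ [true]
            (Function.update u 1 (unaryCode k ++ rest))) :=
        ((does_pop 9).seq ((does_push 2 true).seq (does_push 3 true))).to
          (by simp [hu, unaryCode, List.replicate_succ])
      refine ((Does.loop_step (by simp) (Does.branch_true ?_ h)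
        (ih (a + 1) _ (by simp))).to ?_).mono ?_
      · simp [hu, unaryCode, List.replicate_succ]
      · rw [show a + 1 + k = a + (k + 1) by omega]; simp
      · omega
  refine (((does_push 7 true).to ?_).seq (loop k 0 u hu)).mono ?_ |>.to ?_
  · simp
  · omega
  · simp

/-- Write the code of the fan-out on stack `0`. Stack `2` holds the index of the current target,
stack `4` the number of gates still to be written and stack `7` that of the gates written. -/
def writeFanOut : Prog :=
  .loop 4 (.seq (.pop 4) (.seq (.push 7 true) (.seq (.push 0 false) (.seq (drain 2 [] [1, 0])
    (.seq (drain 1 [] [2]) (.seq (.push 0 false) (.seq (.push 0 true) (.seq (.push 0 true)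
      (.seq (.push 0 true) (.push 2 true))))))))))

theorem does_writeFanOut (m N : ℕ) (w : List Bool) :
    writeFanOut.Does O (regs w [] (𝟏 (m + 1)) a₃ (𝟏 N) a₅ a₆ [] u) (N * (11 * (m + N + 1) + 11) + 1)
      (regs (fanOutCode m N ++ w) [] (𝟏 (m + 1 + N)) a₃ [] a₅ a₆ (𝟏 N) u) := by
  have loop : ∀ k i : ℕ, i + k = N →
      writeFanOut.Does O (regs (fanOutCode m i ++ w) [] (𝟏 (m + 1 + i)) a₃ (𝟏 k) a₅ a₆ (𝟏 i) u)
      (k * (11 * (m + N + 1) + 11) + 1)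
      (regs (fanOutCode m N ++ w) [] (𝟏 (m + 1 + N)) a₃ [] a₅ a₆ (𝟏 N) u) := by
    intro k
    induction k with
    | zero =>
      rintro i rfl
      simpa [writeFanOut] using does_loop_done (by simp)
    | succ k ih =>
      intro i hi
      set J := m + 1 + i with hJ
      set v := fanOutCode m i ++ w with hv
      have h1 : (Prog.pop 4).Does O (regs v [] (𝟏 J) a₃ (𝟏 (k + 1)) a₅ a₆ (𝟏 i) u) 1
          (regs v [] (𝟏 J) a₃ (𝟏 k) a₅ a₆ (𝟏 i) u) := (does_pop 4).to (by simp)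
      have h2 : (Prog.push 7 true).Does O (regs v [] (𝟏 J) a₃ (𝟏 k) a₅ a₆ (𝟏 i) u) 1
          (regs v [] (𝟏 J) a₃ (𝟏 k) a₅ a₆ (𝟏 (i + 1)) u) :=
        (does_push 7 true).to (by simp [List.replicate_succ])
      have h3 : (Prog.push 0 false).Does O (regs v [] (𝟏 J) a₃ (𝟏 k) a₅ a₆ (𝟏 (i + 1)) u) 1
          (regs (false :: v) [] (𝟏 J) a₃ (𝟏 k) a₅ a₆ (𝟏 (i + 1)) u) :=
        (does_push 0 false).to (by simp)
      have h4 : (drain 2 [] [1, 0]).Does O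
          (regs (false :: v) [] (𝟏 J) a₃ (𝟏 k) a₅ a₆ (𝟏 (i + 1)) u) (J * 6 + 1)
          (regs (unaryCode J ++ v) (𝟏 J) [] a₃ (𝟏 k) a₅ a₆ (𝟏 (i + 1)) u) :=
        ((does_drain (by decide) (by decide) (by decide) (by decide)).to
          (by apply store_ext <;> simp [unaryCode])).mono (by simp)
      have h5 : (drain 1 [] [2]).Does O
          (regs (unaryCode J ++ v) (𝟏 J) [] a₃ (𝟏 k) a₅ a₆ (𝟏 (i + 1)) u) (J * 5 + 1)
          (regs (unaryCode J ++ v) [] (𝟏 J) a₃ (𝟏 k) a₅ a₆ (𝟏 (i + 1)) u) :=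
        ((does_drain (by decide) (by decide) (by decide) (by decide)).to
          (by apply store_ext <;> simp)).mono (by simp)
      have h6 : (Prog.seq (.push 0 false) (.seq (.push 0 true) (.seq (.push 0 true)
          (.seq (.push 0 true) (.push 2 true))))).Does O
          (regs (unaryCode J ++ v) [] (𝟏 J) a₃ (𝟏 k) a₅ a₆ (𝟏 (i + 1)) u)
          (1 + (1 + (1 + (1 + 1))))
          (regs (fanOutCode m (i + 1) ++ w) [] (𝟏 (m + 1 + (i + 1))) a₃ (𝟏 k) a₅ a₆
            (𝟏 (i + 1)) u) := by
        refine ((does_push 0 false).seq ((does_push 0 true).seq ((does_push 0 true).seq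
          ((does_push 0 true).seq (does_push 2 true))))).to ?_
        simp [fanOutCode, hv, hJ, ← List.replicate_succ, add_assoc]
      refine ((h1.seq (h2.seq (h3.seq (h4.seq (h5.seq h6))))).loop_step (by simp)
        (ih (i + 1) (by omega))).mono ?_
      have : J ≤ m + N + 1 := by omega
      linarith
  simpa [fanOutCode] using loop N 0 (by omega)

/-- Write the unary code of the number on stack `2` on stack `0`. Then copy stack `3` to stack `2`
and move stack `7` to stack `4`, which makes the store ready for writing another fan-out. -/
def writeHeader : Prog :=
  .seq (.push 0 false) (.seq (drain 2 [] [0]) (.seq (drain 3 [] [1, 2]) (.seq (drain 1 [] [3])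
    (drain 7 [] [4]))))

theorem does_writeHeader (n k N : ℕ) (w : List Bool) :
    writeHeader.Does O (regs w [] (𝟏 n) (𝟏 k) [] a₅ a₆ (𝟏 N) u)
      (n * 5 + k * 11 + N * 5 + 5)
      (regs (unaryCode n ++ w) [] (𝟏 k) (𝟏 k) (𝟏 N) a₅ a₆ [] u) := by
  have h1 : (Prog.push 0 false).Does O (regs w [] (𝟏 n) (𝟏 k) [] a₅ a₆ (𝟏 N) u) 1
      (regs (false :: w) [] (𝟏 n) (𝟏 k) [] a₅ a₆ (𝟏 N) u) := (does_push 0 false).to (by simp)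
  have h2 : (drain 2 [] [0]).Does O (regs (false :: w) [] (𝟏 n) (𝟏 k) [] a₅ a₆ (𝟏 N) u) (n * 5 + 1)
      (regs (unaryCode n ++ w) [] [] (𝟏 k) [] a₅ a₆ (𝟏 N) u) :=
    ((does_drain (by decide) (by decide) (by decide) (by decide)).to
      (by apply store_ext <;> simp [unaryCode])).mono (by simp)
  have h3 : (drain 3 [] [1, 2]).Does O (regs (unaryCode n ++ w) [] [] (𝟏 k) [] a₅ a₆ (𝟏 N) u)
      (k * 6 + 1) (regs (unaryCode n ++ w) (𝟏 k) (𝟏 k) [] [] a₅ a₆ (𝟏 N) u) :=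
    ((does_drain (by decide) (by decide) (by decide) (by decide)).to
      (by apply store_ext <;> simp)).mono (by simp)
  have h4 : (drain 1 [] [3]).Does O (regs (unaryCode n ++ w) (𝟏 k) (𝟏 k) [] [] a₅ a₆ (𝟏 N) u)
      (k * 5 + 1) (regs (unaryCode n ++ w) [] (𝟏 k) (𝟏 k) [] a₅ a₆ (𝟏 N) u) :=
    ((does_drain (by decide) (by decide) (by decide) (by decide)).to
      (by apply store_ext <;> simp)).mono (by simp)
  have h5 : (drain 7 [] [4]).Does O (regs (unaryCode n ++ w) [] (𝟏 k) (𝟏 k) [] a₅ a₆ (𝟏 N) u)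
      (N * 5 + 1) (regs (unaryCode n ++ w) [] (𝟏 k) (𝟏 k) (𝟏 N) a₅ a₆ [] u) :=
    ((does_drain (by decide) (by decide) (by decide) (by decide)).to
      (by apply store_ext <;> simp)).mono (by simp)
  exact (h1.seq (h2.seq (h3.seq (h4.seq h5)))).mono (by omega)

/-- Given the code of a circuit on stack `9` and a unary number on stack `4`, write the
question to the oracle on stack `0`, from its end to its beginning. The gates of the circuit are
kept in reverse order on the stacks `5` and `6`, one copy for each of the two circuits; removing the
top of stack `6` drops the `false` that ends the code, as gates of the fan-out follow there. -/
def writeQuestion : Prog :=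
  .seq splitUnary (.seq (drain 9 [5, 6] []) (.seq (drain 5 [0] []) (.seq writeFanOut
    (.seq writeHeader (.seq (.push 0 false) (.seq writeFanOut (.seq (.pop 6)
      (.seq (drain 6 [0] []) writeHeader))))))))

theorem does_writeQuestion (m N : ℕ) (g : List Bool)
    (hu : u 1 = unaryCode (m + 1) ++ (g ++ [false])) :
    writeQuestion.Does O (regs [] [] [] [] (𝟏 N) [] [] [] u)
      (N * (22 * (m + N + 2)) + 37 * (m + N + 1) + 16 * g.length + 40)
      (regs (unaryCode (m + 1 + N) ++ (g ++ (fanOutCode m N ++ (false ::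
        (unaryCode (m + 1 + N) ++ (fanOutCode m N ++ (g ++ [false])))))))
        [] (𝟏 (m + 1)) (𝟏 (m + 1)) (𝟏 N) [] [] [] (Function.update u 1 [])) := by
  set M := m + 1 with hM
  have h1 := does_splitUnary (O := O) (a₀ := []) (a₁ := []) (a₄ := 𝟏 N) (a₅ := []) (a₆ := [])
    M _ hu
  have h2 : (drain 9 [5, 6] []).Does O
      (regs [] [] (𝟏 M) (𝟏 M) (𝟏 N) [] [] [] (Function.update u 1 (g ++ [false])))
      ((g.length + 1) * 6 + 1)
      (regs [] [] (𝟏 M) (𝟏 M) (𝟏 N) (false :: g.reverse) (false :: g.reverse) []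
        (Function.update u 1 [])) :=
    ((does_drain (by decide) (by decide) (by decide) (by decide)).to
      (by apply store_ext <;> simp [Function.update_apply]; intro r; split_ifs <;> rfl)).mono
      (by simp)
  set u' := Function.update u 1 [] with hu'
  have h3 : (drain 5 [0] []).Does O
      (regs [] [] (𝟏 M) (𝟏 M) (𝟏 N) (false :: g.reverse) (false :: g.reverse) [] u')
      ((g.length + 1) * 5 + 1)
      (regs (g ++ [false]) [] (𝟏 M) (𝟏 M) (𝟏 N) [] (false :: g.reverse) [] u') :=
    ((does_drain (by decide) (by decide) (by decide) (by decide)).to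
      (by apply store_ext <;> simp)).mono (by simp)
  have h4 := does_writeFanOut (O := O) (a₃ := 𝟏 M) (a₅ := []) (a₆ := false :: g.reverse)
    (u := u') m N (g ++ [false])
  have h5 := does_writeHeader (O := O) (a₅ := []) (a₆ := false :: g.reverse)
    (u := u') (M + N) M N (fanOutCode m N ++ (g ++ [false]))
  set w := unaryCode (M + N) ++ (fanOutCode m N ++ (g ++ [false])) with hw
  have h6 : (Prog.push 0 false).Does O
      (regs w [] (𝟏 M) (𝟏 M) (𝟏 N) [] (false :: g.reverse) [] u') 1
      (regs (false :: w) [] (𝟏 M) (𝟏 M) (𝟏 N) [] (false :: g.reverse) [] u') :=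
    (does_push 0 false).to (by simp)
  have h7 := does_writeFanOut (O := O) (a₃ := 𝟏 M) (a₅ := []) (a₆ := false :: g.reverse)
    (u := u') m N (false :: w)
  have h8 : (Prog.pop 6).Does O
      (regs (fanOutCode m N ++ false :: w) [] (𝟏 (M + N)) (𝟏 M) [] [] (false :: g.reverse)
        (𝟏 N) u') 1
      (regs (fanOutCode m N ++ false :: w) [] (𝟏 (M + N)) (𝟏 M) [] [] g.reverse (𝟏 N) u') :=
    (does_pop 6).to (by simp)
  have h9 : (drain 6 [0] []).Does O
      (regs (fanOutCode m N ++ false :: w) [] (𝟏 (M + N)) (𝟏 M) [] [] g.reverse (𝟏 N) u')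
      (g.length * 5 + 1)
      (regs (g ++ (fanOutCode m N ++ false :: w)) [] (𝟏 (M + N)) (𝟏 M) [] [] [] (𝟏 N) u') :=
    ((does_drain (by decide) (by decide) (by decide) (by decide)).to
      (by apply store_ext <;> simp)).mono (by simp)
  have h10 := does_writeHeader (O := O) (a₅ := []) (a₆ := []) (u := u') (M + N) M N
    (g ++ (fanOutCode m N ++ false :: w))
  refine (h1.seq (h2.seq (h3.seq (h4.seq (h5.seq (h6.seq (h7.seq (h8.seq
    (h9.seq h10))))))))).mono ?_
  have e : N * (22 * (m + N + 2)) = 2 * (N * (11 * (m + N + 1) + 11)) := by ring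
  rw [e, hM]
  omega

/-- Ask the oracle and accept if the answer does not start with the bit `1`. -/
def askAndDecide : Prog :=
  .seq (.query 0 7) (.branch 7 (.push 1 true) (.push 1 true) (.push 1 false))

theorem does_askAndDecide (w : List Bool) :
    ∃ s, askAndDecide.Does O (regs w [] a₂ a₃ a₄ a₅ a₆ a₇ u) (w.length + 3) s ∧
      s 1 = [!((O w).head? == some true)] := by
  have hq : (Prog.query 0 7).Does O (regs w [] a₂ a₃ a₄ a₅ a₆ a₇ u) (w.length + 1)
      (regs w [] a₂ a₃ a₄ a₅ a₆ (O w) u) := (does_query 0 7).to (by simp)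
  rcases h : O w with _ | ⟨_ | _, l⟩
  · exact ⟨_, hq.seq (Does.branch_nil (by simp [h]) (does_push 1 true)), by simp⟩
  · exact ⟨_, hq.seq (Does.branch_false (by simp [h]) (does_push 1 true)), by simp⟩
  · exact ⟨_, hq.seq (Does.branch_true (by simp [h]) (does_push 1 false)), by simp⟩

end Prog

/-! ### Codes of the circuits -/

/-- The code of a list of gates without the final `false`. -/
def gatesBody {n : ℕ} (c : Circuit n) : List Bool := c.flatMap fun g => true :: g.code

theorem gatesCode_eq {n : ℕ} (c : Circuit n) : gatesCode c = gatesBody c ++ [false] := by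
  induction c with
  | nil => rfl
  | cons g c ih => simp [gatesCode, gatesBody, ih]

theorem gatesBody_append {n : ℕ} (c d : Circuit n) :
    gatesBody (c ++ d) = gatesBody c ++ gatesBody d := by
  simp [gatesBody]

theorem length_le_gatesBody {n : ℕ} (c : Circuit n) : c.length ≤ (gatesBody c).length := by
  induction c with
  | nil => simp
  | cons g c ih =>
    simp only [gatesBody, List.flatMap_cons, List.length_append, List.length_cons] at ih ⊢
    omega

theorem gatesBody_lift {n : ℕ} (N : ℕ) (c : Circuit n) :
    gatesBody (c.map (Gate.lift N)) = gatesBody c := by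
  have : ∀ g : Gate n, (g.lift N).code = g.code := by
    rintro (i | i | i | i) <;> simp [Gate.lift, Gate.code]
  simp [gatesBody, List.flatMap_map, this]

theorem gatesBody_fanOut (m N k : ℕ) (h : k ≤ N) :
    gatesBody (fanOut m N k h) = fanOutCode m k := by
  induction k with
  | zero => rfl
  | succ k ih =>
    have cons : ∀ (g : Gate (m + 1 + N)) c, gatesBody (g :: c) = true :: (g.code ++ gatesBody c) :=
      fun g c => by simp [gatesBody]
    rw [fanOut, cons, ih, fanOutCode]
    simp [Gate.code, unaryCode]

theorem circuitCode_eq {n : ℕ} (c : Circuit n) :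
    circuitCode c = unaryCode n ++ (gatesBody c ++ [false]) := by
  rw [circuitCode, gatesCode_eq]

theorem pairCode_fan {m : ℕ} (N : ℕ) (Q : Circuit (m + 1)) :
    pairCode (fanAfter N Q) (fanBefore N Q) =
      unaryCode (m + 1 + N) ++ (gatesBody Q ++ (fanOutCode m N ++ (false ::
        (unaryCode (m + 1 + N) ++ (fanOutCode m N ++ (gatesBody Q ++ [false])))))) := by
  simp only [pairCode, circuitCode_eq, fanAfter, fanBefore, gatesBody_append, gatesBody_lift,
    gatesBody_fanOut]
  simp

/-! ### The reduction -/

namespace Prog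

/-- The reduction, where `P` writes the one-clean-qubit circuit and `(|x| + c) ^ d` qubits are
added to it. -/
def reduction (P : Prog) (c d : ℕ) : Prog :=
  .seq (prepare c d) (.seq P.shift (.seq writeQuestion askAndDecide))

theorem does_reduction {O : List Bool → List Bool} {P : Prog} (hP : P.QueryFree) {c d : ℕ}
    (hc : 1 ≤ c) (hd : 1 ≤ d) {x : List Bool} {t : ℕ} {s : Store}
    (hr : P.Runs (fun _ => []) (initStore x) t s) {m : ℕ} {Q : Circuit (m + 1)}
    (hs : s 1 = circuitCode Q) {N : ℕ} (hN : N = (x.length + c) ^ d) (ht : t ≤ N) :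
    ∃ s', (reduction P c d).Does O (initStore x) (48 * N ^ 2 + (22 * d + 200) * N + 100) s' ∧
      s' 1 = [!((O (pairCode (fanAfter N Q) (fanBefore N Q))).head? == some true)] := by
  have hlen := hr.length_le hP 1
  rw [hs, circuitCode_eq] at hlen
  simp only [List.length_append, unaryCode, List.length_replicate, List.length_cons,
    List.length_nil, initStore, one_ne_zero, if_false] at hlen
  have h1 := does_prepare (O := O) (d := d) hc x
  rw [← hN] at h1
  have h2 : P.shift.Does O (regs [] [] [] [] (List.replicate N true) [] [] [] (initStore x)) t _ :=
    ⟨t, le_rfl, hr.shift hP _ _ _ _ _ _ _ _⟩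
  have h3 := does_writeQuestion (O := O) m N (gatesBody Q) (hs.trans (circuitCode_eq Q))
  rw [← pairCode_fan] at h3
  obtain ⟨s', h4, h5⟩ := does_askAndDecide (O := O) (a₂ := List.replicate (m + 1) true)
    (a₃ := List.replicate (m + 1) true) (a₄ := List.replicate N true) (a₅ := []) (a₆ := [])
    (a₇ := []) (u := Function.update s 1 []) (pairCode (fanAfter N Q) (fanBefore N Q))
  refine ⟨s', (h1.seq (h2.seq (h3.seq h4))).mono ?_, h5⟩
  have hcN : x.length + c ≤ N := hN ▸ Nat.le_self_pow (by omega) _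
  have hf := fanOutCode_length_le m N
  have e1 : N * (22 * (m + N + 2)) ≤ N * (22 * (2 * N + 1)) := Nat.mul_le_mul_left _ (by omega)
  have e2 : N * (m + N + 6) ≤ N * (2 * N + 5) := Nat.mul_le_mul_left _ (by omega)
  rw [pairCode_fan]
  simp only [List.length_append, unaryCode, List.length_replicate, List.length_cons,
    List.length_nil]
  have e3 : N * (22 * (2 * N + 1)) = 44 * N ^ 2 + 22 * N := by ring
  have e4 : N * (2 * N + 5) = 2 * N ^ 2 + 5 * N := by ring
  have e5 : (22 * d + 200) * N = d * (22 * N) + 200 * N := by ring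
  rw [e5]
  omega

end Prog

/-! ### Choosing the parameters -/

theorem Polynomial.exists_eval_le_add_pow (p : Polynomial ℕ) :
    ∃ c d : ℕ, 1 ≤ c ∧ 1 ≤ d ∧ ∀ n, p.eval n ≤ (n + c) ^ d := by
  set S := ∑ i ∈ Finset.range (p.natDegree + 1), p.coeff i with hS
  refine ⟨S + 1, p.natDegree + 1, by omega, by omega, fun n => ?_⟩
  calc p.eval n = ∑ i ∈ Finset.range (p.natDegree + 1), p.coeff i * n ^ i :=
        Polynomial.eval_eq_sum_range n
    _ ≤ ∑ i ∈ Finset.range (p.natDegree + 1), p.coeff i * (n + (S + 1)) ^ p.natDegree := by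
        refine Finset.sum_le_sum fun i hi => Nat.mul_le_mul_left _ ?_
        calc n ^ i ≤ (n + (S + 1)) ^ i := Nat.pow_le_pow_left (by omega) _
          _ ≤ (n + (S + 1)) ^ p.natDegree :=
            Nat.pow_le_pow_right (by omega) (Nat.lt_succ_iff.mp (Finset.mem_range.mp hi))
    _ = S * (n + (S + 1)) ^ p.natDegree := by rw [hS, Finset.sum_mul]
    _ ≤ (n + (S + 1)) * (n + (S + 1)) ^ p.natDegree := Nat.mul_le_mul_right _ (by omega)
    _ = (n + (S + 1)) ^ (p.natDegree + 1) := by ring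

/-- An error of size `O(n ^ -k)` in the average is an error `O(1)` in the sum over the qubits. -/
theorem exists_mul_le_of_isBigO {ε : ℕ → ℝ} {k : ℕ} (hk : 1 ≤ k)
    (h : ε =O[atTop] fun n : ℕ => 1 / (n : ℝ) ^ k) :
    ∃ C N₀ : ℕ, ∀ n ≥ N₀, n * ε n ≤ C := by
  obtain ⟨c, hc⟩ := h.bound
  obtain ⟨N₀, hN₀⟩ := eventually_atTop.mp hc
  refine ⟨⌈max c 0⌉₊, N₀ + 1, fun n hn => ?_⟩
  have hn1 : (1 : ℝ) ≤ n := by exact_mod_cast (by omega : 1 ≤ n)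
  have hn0 : (0 : ℝ) < n := by linarith
  have h1 := (le_abs_self _).trans (hN₀ n (by omega))
  rw [Real.norm_of_nonneg (by positivity)] at h1
  have h2 : (n : ℝ) * (1 / (n : ℝ) ^ k) ≤ 1 := by
    rw [mul_one_div, div_le_one (by positivity)]
    exact le_self_pow₀ hn1 (by omega)
  calc (n : ℝ) * ε n ≤ n * (max c 0 * (1 / (n : ℝ) ^ k)) := by
        refine mul_le_mul_of_nonneg_left (h1.trans ?_) hn0.le
        exact mul_le_mul_of_nonneg_right (le_max_left _ _) (by positivity)
    _ = max c 0 * (n * (1 / (n : ℝ) ^ k)) := by ring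
    _ ≤ max c 0 * 1 := mul_le_mul_of_nonneg_left h2 (le_max_right _ _)
    _ ≤ ⌈max c 0⌉₊ := by rw [mul_one]; exact Nat.le_ceil _

theorem binFrac_mem_Icc (l : List Bool) : binFrac l ∈ Set.Icc 0 1 := by
  induction l with
  | nil => simp [binFrac]
  | cons b l ih =>
    obtain ⟨h0, h1⟩ := ih
    cases b <;> simp only [binFrac] <;> constructor <;> norm_num <;> linarith

theorem half_le_binFrac {l : List Bool} (h : l.head? = some true) : 1 / 2 ≤ binFrac l := by
  obtain ⟨l, rfl⟩ := List.head?_eq_some_iff.mp h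
  have := (binFrac_mem_Icc l).1
  simp only [binFrac, if_true]
  linarith

theorem binFrac_le_half {l : List Bool} (h : l.head? ≠ some true) : binFrac l ≤ 1 / 2 := by
  rcases l with _ | ⟨_ | _, l⟩
  · simp [binFrac]
  · have := (binFrac_mem_Icc l).2
    simp only [binFrac]
    norm_num
    linarith
  · simp at h

/-- The first bit of an approximation of the cost tells large from small acceptance
probabilities, once sufficiently many qubits have been added. -/
theorem head_answer {m N C : ℕ} {Q : Circuit (m + 1)} {δ e : ℝ} {y : List Bool}
    (hN : 2 * (m + 1) + C < N * δ) (he : ((m + 1 + N : ℕ) : ℝ) * e ≤ C)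
    (hy : |binFrac y - costLHST (fanAfter N Q).toOp (fanBefore N Q).toOp| ≤ e) :
    (1 / 2 + δ ≤ acceptProb Q → y.head? ≠ some true) ∧
      (acceptProb Q ≤ 1 / 2 - δ → y.head? = some true) := by
  obtain ⟨hl, hu⟩ := costLHST_fan_mem_Icc N Q
  set n : ℝ := ((m + 1 + N : ℕ) : ℝ) with hn
  set K := costLHST (fanAfter N Q).toOp (fanBefore N Q).toOp
  have hn' : n = m + 1 + N := by rw [hn]; push_cast; ring
  have hn0 : 0 < n := by rw [hn']; positivity
  have hm0 : (0 : ℝ) ≤ m := m.cast_nonneg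
  have hN0 : (0 : ℝ) ≤ N := N.cast_nonneg
  obtain ⟨h1, h2⟩ := abs_le.mp hy
  have h1' : n * K - C ≤ n * binFrac y := by
    have := mul_le_mul_of_nonneg_left h1 hn0.le
    linarith [mul_sub n (binFrac y) K]
  have h2' : n * binFrac y ≤ n * K + C := by
    have := mul_le_mul_of_nonneg_left h2 hn0.le
    linarith [mul_sub n (binFrac y) K]
  constructor
  · intro hp hh
    have h3 := mul_le_mul_of_nonneg_left (half_le_binFrac hh) hn0.le
    have h4 := mul_le_mul_of_nonneg_left hp hN0
    linarith
  · intro hp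
    by_contra hh
    have h3 := mul_le_mul_of_nonneg_left (binFrac_le_half hh) hn0.le
    have h4 := mul_le_mul_of_nonneg_left hp hN0
    linarith

theorem mainTheorem4 :
    ∃ size : Polynomial ℕ, ∀ ε : ℕ → ℝ, (∀ n, 0 < ε n) →
      (∃ k : ℕ, 1 ≤ k ∧ ε =O[atTop] fun n : ℕ => 1 / (n : ℝ) ^ k) →
      IsDQC1Hard (approxLHST size ε) := by
  refine ⟨2 * Polynomial.X, fun ε _ ⟨k, hk, hε⟩ L ⟨m, Q, q, ⟨P, hP, p, hp⟩, hyes, hno⟩ => ?_⟩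
  obtain ⟨C, N₀, hC⟩ := exists_mul_le_of_isBigO hk hε
  -- The number of added qubits dominates the running time of `P`, the threshold `N₀`, and the
  -- error terms divided by the gap `1 / (q + 1)`.
  obtain ⟨c, d, hc, hd, hcd⟩ := Polynomial.exists_eval_le_add_pow
    (p + (N₀ : Polynomial ℕ) + (2 * p + (C : Polynomial ℕ) + 1) * (q + 1))
  refine ⟨Prog.reduction P c d,
    48 * ((Polynomial.X + (c : Polynomial ℕ)) ^ d) ^ 2 +
      ((22 * d + 200 : ℕ) : Polynomial ℕ) * (Polynomial.X + (c : Polynomial ℕ)) ^ d + 100,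
    fun O hO x => ?_⟩
  obtain ⟨t, s, hrun, ht, hs⟩ := hp x
  change s 1 = circuitCode (Q x) at hs
  set N := (x.length + c) ^ d with hN
  have hbig := hcd x.length
  rw [← hN] at hbig
  simp only [Polynomial.eval_add, Polynomial.eval_mul, Polynomial.eval_natCast,
    Polynomial.eval_ofNat, Polynomial.eval_one, Nat.cast_id] at hbig
  set a := p.eval x.length
  set b := q.eval x.length
  have hlen := hrun.length_le hP 1
  rw [hs, circuitCode_eq] at hlen
  simp only [List.length_append, unaryCode, List.length_replicate, List.length_cons,
    List.length_nil, initStore, one_ne_zero, if_false] at hlen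
  have hQ := length_le_gatesBody (Q x)
  have haN : a + N₀ ≤ N := le_trans (Nat.le_add_right _ _) hbig
  obtain ⟨s', ⟨t', ht', hrun'⟩, hs'⟩ :=
    Prog.does_reduction (O := O) hP hc hd hrun hs hN (ht.trans (by omega))
  refine ⟨t', s', hrun', ht'.trans ?_, ?_⟩
  · simp [hN]
  have hy := hO (pairCode (fanAfter N (Q x)) (fanBefore N (Q x))) _ _ _ (by omega)
    (by simp [fanAfter, fanOut_length]; omega) (by simp [fanBefore, fanOut_length]; omega) rfl
  have hgap : 2 * ((m x : ℝ) + 1) + C < N * (1 / ((b : ℝ) + 1)) := by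
    rw [mul_one_div, lt_div_iff₀ (by positivity)]
    have h1 : (2 * (m x + 1) + C) * (b + 1) < N := by
      have : (2 * (m x + 1) + C) * (b + 1) < (2 * a + C + 1) * (b + 1) :=
        Nat.mul_lt_mul_of_pos_right (by omega) (by omega)
      omega
    exact_mod_cast h1
  obtain ⟨h1, h2⟩ := head_answer hgap (hC _ (by omega)) hy
  constructor
  · intro hx
    simp [hs', h1 (hyes x hx)]
  · intro hx
    simp [hs', h2 (hno x hx)]
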